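/- **Setting.** $\mathcal D'$ is the space of complex Schwartz distributions on $\mathbb R$. A function is piecewise smooth if it is smooth off a finite set of points at which it and all its derivatives have finite left and right limits. $\mathcal A\subset\mathcal D'$ is the set of all piecewise smooth functions, regarded as distributions, together with all their distributional derivatives. For $F,G\in\mathcal A$ put $$F*G=\lim_{\epsilon\downarrow0}F(x)\cdot G(x+\epsilon)\quad\text{in }\mathcal D',$$ where $\cdot$ is the Hörmander product of distributions with disjoint singular supports (locally one factor is a smooth function, and the product is the dual product of the other factor by it). All derivatives of distributions are distributional, and $H$ is the Heaviside function. Let $\xi_0\in\mathbb R$, $w\in\mathbb C$, and for $i=0,1$ let $$a_i=a_{i-}H(\xi_0-x)+a_{i+}H(x-\xi_0)+\sum_{j=0}^1A_{ij}\delta_{\xi_0}^{(j)},\qquad b_i=b_{i-}H(\xi_0-x)+b_{i+}H(x-\xi_0)+\sum_{j=0}^3B_{ij}\delta_{\xi_0}^{(j)},$$ with $a_{i\pm},b_{i\pm}\in\mathcal C^\infty(\mathbb R,\mathbb C)$ and $A_{ij},B_{ij}\in\mathbb C$. Put $a=a_{0-}+a_{1+}$ and $a_\pm=a_{0\pm}+a_{1\pm}$,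 and assume $a(\xi_0)\neq0$ and $a_\pm(x)\neq0$ for all $x\in\mathbb R$. Consider the equation $$\sum_{i=0}^2\binom2i\left(a_0^{(i)}*\phi^{(4-i)}+\phi^{(4-i)}*a_1^{(i)}\right)-w^2\left(b_0*\phi+\phi*b_1\right)=0.\tag{E}$$ A solution of (E) is a $\phi\in\mathcal A$ that satisfies (E) in $\mathcal D'$. For $x_0\ne\xi_0$ and $C\in\mathbb C^4$, the boundary condition $(\phi,\phi',\phi'',\phi''')^T(x_0)=C$ means that on an open interval containing $x_0$ the distribution $\phi$ is a smooth function whose derivatives of orders $0,1,2,3$ at $x_0$ are the components of $C$. Define the matrices (all functions evaluated at $\xi_0$) $$\mathbf A(\xi_0)=\begin{pmatrix}B_{10}w^2&-B_{11}w^2&a_-'+B_{12}w^2&a_--B_{13}w^2\\B_{11}w^2&-2B_{12}w^2&a_-+3B_{13}w^2&0\\-a'+B_{12}w^2&a-3B_{13}w^2&-A_{10}&A_{11}\\a+B_{13}w^2&0&-A_{11}&0\end{pmatrix},$$ $$\mathbf B(\xi_0)=\begin{pmatrix}-B_{00}w^2&B_{01}w^2&a_+'-B_{02}w^2&a_++B_{03}w^2\\-B_{01}w^2&2B_{02}w^2&a_+-3B_{03}w^2&0\\-a'-B_{02}w^2&a+3B_{03}w^2&A_{00}&-A_{01}\\a-B_{03}w^2&0&A_{01}&0\end{pmatrix}.$$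 **Corollary 3.4.** Let $C\in\mathbb C^4$ be arbitrary. If $x_0<\xi_0$, then (E) has exactly one solution with $(\phi,\phi',\phi'',\phi''')^T(x_0)=C$ if and only if $\det\mathbf B(\xi_0)\neq0$. If $x_0>\xi_0$, then (E) has exactly one solution with $(\phi,\phi',\phi'',\phi''')^T(x_0)=C$ if and only if $\det\mathbf A(\xi_0)\neq0$. -/

import Mathlib

open scoped Distributions LineDeriv ContDiff Topology
open TopologicalSpace MeasureTheory Filter

noncomputable section

namespace Beam

/-! ### Schwartz distributions on the real line -/

/-- Test functions on `ℝ`. As in Mathlib's `Distribution`, they are real valued; a complex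
distribution is determined by its values on them. -/
abbrev Test : Type := 𝓓((⊤ : Opens ℝ), ℝ)

/-- Complex Schwartz distributions on `ℝ`. -/
abbrev Dist : Type := 𝓓'((⊤ : Opens ℝ), ℂ)

/-- The regular distribution `t ↦ ∫ t(x) f(x) dx` of a locally integrable function `f`. -/
def regular (f : ℝ → ℂ) : Dist :=
  TestFunction.integralAgainstBilinCLM (ContinuousLinearMap.lsmul ℝ ℝ) volume f

/-- The Dirac measure at `ξ`, as a complex distribution. -/
def dirac (ξ : ℝ) : Dist :=
  Distribution.mapCLM Complex.ofRealCLM (Distribution.delta ξ)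

/-- The `k`-th distributional derivative. -/
def D (k : ℕ) (F : Dist) : Dist := (fun G : Dist => ∂_{(1 : ℝ)} G)^[k] F

/-- The test function `x ↦ t (x - ε)`. -/
def shiftTest (ε : ℝ) (t : Test) : Test where
  toFun x := t (x - ε)
  contDiff' := t.contDiff.comp (contDiff_id.sub contDiff_const)
  hasCompactSupport' := by
    have := t.hasCompactSupport.comp_homeomorph (Homeomorph.subRight ε)
    simpa [Function.comp_def] using this
  tsupport_subset' := fun _ _ => trivial

/-- Translation of test functions is continuous. -/
def shiftTestCLM (ε : ℝ) : Test →L[ℝ] Test :=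
  TestFunction.limitCLM ℝ (shiftTest ε)
    (fun K _ =>
      (TestFunction.ofSupportedInCLM ℝ (K := ⟨(fun x => x + ε) '' (K : Set ℝ),
          K.isCompact.image (by fun_prop)⟩) (fun _ _ => trivial)) ∘L
        ContDiffMapSupportedIn.mkCLM ℝ (fun t x => t (x - ε))
          (fun _ _ _ => rfl) (fun _ _ _ => rfl)
          (fun t => t.contDiff.comp (contDiff_id.sub contDiff_const))
          (fun t x hx => t.zero_on_compl (fun h => hx ⟨x - ε, h, by simp⟩))
          (fun i _ => ⟨{i}, 1, zero_le_one, fun t x _ => by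
            rw [iteratedFDeriv_comp_sub, one_mul, Finset.sup_singleton]
            exact ContDiffMapSupportedIn.norm_iteratedFDeriv_apply_le_seminorm ℝ le_top⟩))
    (fun K _ t => by ext x; rfl)

/-- The translate `G(x + ε)` of a distribution `G`. -/
def translate (ε : ℝ) (G : Dist) : Dist :=
  (shiftTestCLM ε).precompCompactConvergenceCLM ℂ G

/-- `F` coincides with the function `f` on the open set `Ξ`. -/
def EqFunOn (F : Dist) (f : ℝ → ℂ) (Ξ : Set ℝ) : Prop :=
  ∀ t : Test, tsupport t ⊆ Ξ → F t = ∫ x, t x • f x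

/-- `P` coincides on the open set `Ξ` with the dual product `G g` of the distribution `G` by
the function `g`, smooth on `Ξ`: `⟨P, t⟩ = ⟨G, g t⟩` for all test functions `t` supported in `Ξ`.
As test functions are real, `g t` is entered through its real part `u` and imaginary part `v`
(which are always test functions, because `t` has compact support in `Ξ`). -/
def EqDualProductOn (P G : Dist) (g : ℝ → ℂ) (Ξ : Set ℝ) : Prop :=
  ∀ t u v : Test, tsupport t ⊆ Ξ → (∀ x, u x = (g x).re * t x) →
    (∀ x, v x = (g x).im * t x) → P t = G u + Complex.I * G v

/-- `P` is the Hörmander product `F · G`: there is a finite open cover of `ℝ` such that on each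
of its sets one of `F`, `G` is a smooth function, and `P` is there the dual product of the other
one by that function. For `F` and `G` with finite singular supports such a cover exists exactly if
the singular supports are disjoint. `P` is determined by `F` and `G`. -/
def IsHormanderProduct (F G P : Dist) : Prop :=
  ∃ (d : ℕ) (Ξ : Fin d → Set ℝ), (∀ i, IsOpen (Ξ i)) ∧ (⋃ i, Ξ i) = Set.univ ∧
    ∀ i, ∃ g : ℝ → ℂ, ContDiffOn ℝ ∞ g (Ξ i) ∧
      ((EqFunOn F g (Ξ i) ∧ EqDualProductOn P G g (Ξ i)) ∨
        (EqFunOn G g (Ξ i) ∧ EqDualProductOn P F g (Ξ i)))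

/-- `P = F * G`, i.e. `P = lim_{ε ↓ 0} F(x) · G(x + ε)` with the Hörmander product, which has to
exist for all small `ε > 0`, and the limit in the sense of distributions. The limit `P` is
determined by `F` and `G`. -/
def IsStarProduct (F G P : Dist) : Prop :=
  ∃ Q : ℝ → Dist, (∀ᶠ ε in 𝓝[>] (0 : ℝ), IsHormanderProduct F (translate ε G) (Q ε)) ∧
    ∀ t : Test, Tendsto (fun ε => Q ε t) (𝓝[>] (0 : ℝ)) (𝓝 (P t))

/-- Piecewise smooth functions: smooth off a finite set of points, at which the function and all
its derivatives have finite left and right limits. -/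
def PiecewiseSmooth (f : ℝ → ℂ) : Prop :=
  ∃ S : Finset ℝ, ContDiffOn ℝ ∞ f (S : Set ℝ)ᶜ ∧ ∀ x ∈ S, ∀ k : ℕ,
    (∃ l : ℂ, Tendsto (iteratedDeriv k f) (𝓝[<] x) (𝓝 l)) ∧
    (∃ l : ℂ, Tendsto (iteratedDeriv k f) (𝓝[>] x) (𝓝 l))

/-- The space `𝒜`: piecewise smooth functions, as distributions, and all their distributional
derivatives. -/
def spaceA : Set Dist :=
  {F | ∃ (k : ℕ) (f : ℝ → ℂ), PiecewiseSmooth f ∧ F = D k (regular f)}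

/-! ### The beam equation with one singular point -/

/-- The Heaviside function. -/
def heaviside (x : ℝ) : ℂ := if 0 < x then 1 else 0

/-- The distribution `f₋ H(ξ - x) + f₊ H(x - ξ) + ∑_{j < n} c_j δ_ξ^{(j)}`. -/
def singularCoeff {n : ℕ} (ξ : ℝ) (fm fp : ℝ → ℂ) (c : Fin n → ℂ) : Dist :=
  regular (fun x => fm x * heaviside (ξ - x) + fp x * heaviside (x - ξ)) +
    ∑ j : Fin n, c j • D j (dirac ξ)

/-- The data of the eigenvalue equation: the singular point `ξ`, the number `w`, the smooth
functions `a_{i-}`, `a_{i+}`, `b_{i-}`, `b_{i+}` and the numbers `A_{ij}`, `B_{ij}`, where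
`i` is `0` or `1`. -/
structure Data where
  ξ : ℝ
  w : ℂ
  am : Fin 2 → ℝ → ℂ
  ap : Fin 2 → ℝ → ℂ
  bm : Fin 2 → ℝ → ℂ
  bp : Fin 2 → ℝ → ℂ
  A : Fin 2 → Fin 2 → ℂ
  B : Fin 2 → Fin 4 → ℂ
  am_smooth : ∀ i, ContDiff ℝ ∞ (am i)
  ap_smooth : ∀ i, ContDiff ℝ ∞ (ap i)
  bm_smooth : ∀ i, ContDiff ℝ ∞ (bm i)
  bp_smooth : ∀ i, ContDiff ℝ ∞ (bp i)

namespace Data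

variable (E : Data)

/-- The coefficient `a_i`. -/
def coeffA (i : Fin 2) : Dist := singularCoeff E.ξ (E.am i) (E.ap i) (E.A i)

/-- The coefficient `b_i`. -/
def coeffB (i : Fin 2) : Dist := singularCoeff E.ξ (E.bm i) (E.bp i) (E.B i)

/-- The function `a = a_{0-} + a_{1+}`. -/
def a (x : ℝ) : ℂ := E.am 0 x + E.ap 1 x

/-- The function `a_- = a_{0-} + a_{1-}`. -/
def aMinus (x : ℝ) : ℂ := E.am 0 x + E.am 1 x

/-- The function `a_+ = a_{0+} + a_{1+}`. -/
def aPlus (x : ℝ) : ℂ := E.ap 0 x + E.ap 1 x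

/-- `φ ∈ 𝒜` is a solution of
`∑_{i=0}^2 (2 choose i) (a₀^{(i)} * φ^{(4-i)} + φ^{(4-i)} * a₁^{(i)}) - w² (b₀ * φ + φ * b₁) = 0`;
`P i, Q i, R, S` are the products that occur in it. -/
def IsSolution (φ : Dist) : Prop :=
  φ ∈ spaceA ∧ ∃ (P Q : Fin 3 → Dist) (R S : Dist),
    (∀ i : Fin 3, IsStarProduct (D i (E.coeffA 0)) (D (4 - i) φ) (P i)) ∧
    (∀ i : Fin 3, IsStarProduct (D (4 - i) φ) (D i (E.coeffA 1)) (Q i)) ∧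
    IsStarProduct (E.coeffB 0) φ R ∧
    IsStarProduct φ (E.coeffB 1) S ∧
    ∑ i : Fin 3, (Nat.choose 2 i : ℂ) • (P i + Q i) - E.w ^ 2 • (R + S) = 0

/-- The interface matrix `𝐀(ξ)`. -/
def matA : Matrix (Fin 4) (Fin 4) ℂ :=
  !![E.B 1 0 * E.w ^ 2, -(E.B 1 1 * E.w ^ 2),
      deriv E.aMinus E.ξ + E.B 1 2 * E.w ^ 2, E.aMinus E.ξ - E.B 1 3 * E.w ^ 2;
    E.B 1 1 * E.w ^ 2, -(2 * E.B 1 2 * E.w ^ 2), E.aMinus E.ξ + 3 * E.B 1 3 * E.w ^ 2, 0;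
    -deriv E.a E.ξ + E.B 1 2 * E.w ^ 2, E.a E.ξ - 3 * E.B 1 3 * E.w ^ 2, -E.A 1 0, E.A 1 1;
    E.a E.ξ + E.B 1 3 * E.w ^ 2, 0, -E.A 1 1, 0]

/-- The interface matrix `𝐁(ξ)`. -/
def matB : Matrix (Fin 4) (Fin 4) ℂ :=
  !![-(E.B 0 0 * E.w ^ 2), E.B 0 1 * E.w ^ 2,
      deriv E.aPlus E.ξ - E.B 0 2 * E.w ^ 2, E.aPlus E.ξ + E.B 0 3 * E.w ^ 2;
    -(E.B 0 1 * E.w ^ 2), 2 * E.B 0 2 * E.w ^ 2, E.aPlus E.ξ - 3 * E.B 0 3 * E.w ^ 2, 0;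
    -deriv E.a E.ξ - E.B 0 2 * E.w ^ 2, E.a E.ξ + 3 * E.B 0 3 * E.w ^ 2, E.A 0 0, -E.A 0 1;
    E.a E.ξ - E.B 0 3 * E.w ^ 2, 0, E.A 0 1, 0]

end Data

/-- `φ` takes the boundary values `C`, i.e. near `x₀` it is a smooth function whose derivatives
of orders `0, 1, 2, 3` at `x₀` are the components of `C`. -/
def HasBoundaryData (φ : Dist) (x₀ : ℝ) (C : Fin 4 → ℂ) : Prop :=
  ∃ (p q : ℝ) (ψ : ℝ → ℂ), p < x₀ ∧ x₀ < q ∧ ContDiff ℝ ∞ ψ ∧ EqFunOn φ ψ (Set.Ioo p q) ∧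
    ∀ i : Fin 4, iteratedDeriv i ψ x₀ = C i

end Beam

end

/-! Off `ξ` the coefficients are smooth, so star products there are ordinary products. Since `∑ (2
choose i) f^{(i)} φ^{(4-i)} = (f φ'')''`, the equation reads `(a_∓ φ'')'' = w² (b_{0∓} + b_{1∓}) φ`
on the left and right half-line. As `a_∓` has no zero, weak solutions are classical, and each
extends to a smooth solution `um` or `up` on all of `ℝ` (`IsSolution.weak`,
`exists_isBeamSol_of_weak`). A solution in `𝒜` is a finite-order derivative of a locally integrable
function, hence it equals `pw ξ um up` plus a finite sum of derivatives of `δ_ξ`, encoded by a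
polynomial `p` (`exists_rep`).

For such normal forms the star product is explicit (`Rep.exists_isStarProduct`): replacing `G(x)` by
`G(x + ε)` moves the singularity of `G` to `ξ - ε`, where `F` is its left branch, while at `ξ` the
factor `G(x + ε)` is its right branch. Hence point parts of `F` get multiplied by the right branch
of `G`, and point parts of `G` by the left branch of `F`. Inserted into the equation, the regular
parts cancel and a functional supported at `ξ` remains, `interface`, which has to vanish.

Its top-order coefficient is `a(ξ)` times the leading coefficient of `p`: the left branch of `a₀`
and the right branch of `a₁` survive, whence the hypothesis on `a = a_{0-} + a_{1+}`. So `p = 0`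
(`eq_zero_of_interface`). For `p = 0` the functional involves only the 3-jets of `um`, `up` and of
the test function, and its vanishing is `𝐀 (jet um) = 𝐁 (jet up)` at `ξ` (`interface_zero`).

Boundary data at `x₀` fix the branch on the side of `x₀`. The other branch is determined by its jet
at `ξ`, which solves a linear system with matrix `𝐁` if `x₀ < ξ`, and `𝐀` if `x₀ > ξ`. This is
uniquely solvable if the determinant is nonzero; otherwise a kernel vector produces a second
solution with the same data from any given one (`existsUnique_iff_det_ne_zero`).

Test functions are real, so computations use the complex pairing `cev`. It is linear on all
functions, but carries information only on complex test functions. -/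

noncomputable section

namespace Beam

section

/-! ### Complex test functions and the complexified pairing -/

/-- Complex test functions supported in `U`. -/
def testSub (U : Set ℝ) : Submodule ℂ (ℝ → ℂ) where
  carrier := {g | ContDiff ℝ ∞ g ∧ HasCompactSupport g ∧ tsupport g ⊆ U}
  add_mem' := fun {f g} hf hg => ⟨hf.1.add hg.1, hf.2.1.add hg.2.1,
    (tsupport_add f g).trans (Set.union_subset hf.2.2 hg.2.2)⟩
  zero_mem' := ⟨contDiff_const, HasCompactSupport.zero, by simp [tsupport]⟩
  smul_mem' := fun c f hf => ⟨contDiff_const.smul hf.1, hf.2.1.smul_left (f := fun _ => c),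
    (tsupport_smul_subset_right (fun _ => c) f).trans hf.2.2⟩

variable {U V : Set ℝ} {f g h s t : ℝ → ℂ}

theorem testSub_mono (hUV : U ⊆ V) (hs : s ∈ testSub U) : s ∈ testSub V :=
  ⟨hs.1, hs.2.1, hs.2.2.trans hUV⟩

theorem testSub_univ (hs : s ∈ testSub U) : s ∈ testSub Set.univ :=
  testSub_mono (Set.subset_univ _) hs

theorem mul_mem_testSub (hh : ContDiff ℝ ∞ h) (hs : s ∈ testSub U) : h * s ∈ testSub U :=
  ⟨hh.mul hs.1, hs.2.1.mul_left, (tsupport_mul_subset_right).trans hs.2.2⟩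

theorem deriv_mem_testSub (hs : s ∈ testSub U) : deriv s ∈ testSub U :=
  ⟨(contDiff_infty_iff_deriv.1 hs.1).2, hs.2.1.deriv, (tsupport_deriv_subset (𝕜 := ℝ)).trans hs.2.2⟩

theorem contDiff_iteratedDeriv (hs : ContDiff ℝ ∞ s) (k : ℕ) :
    ContDiff ℝ ∞ (iteratedDeriv k s) := by
  induction k with
  | zero => simpa using hs
  | succ k ih => rw [iteratedDeriv_succ]; exact (contDiff_infty_iff_deriv.1 ih).2

theorem iteratedDeriv_mem_testSub (hs : s ∈ testSub U) (k : ℕ) :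
    iteratedDeriv k s ∈ testSub U := by
  induction k with
  | zero => simpa using hs
  | succ k ih => rw [iteratedDeriv_succ]; exact deriv_mem_testSub ih

theorem shift_mem_testSub (hs : s ∈ testSub U) (ε : ℝ) :
    (fun x => s (x - ε)) ∈ testSub ((fun x => x - ε) ⁻¹' U) := by
  refine ⟨hs.1.comp (contDiff_id.sub contDiff_const), ?_, ?_⟩
  · simpa [Function.comp_def] using hs.2.1.comp_homeomorph (Homeomorph.subRight ε)
  · have := tsupport_comp_eq_preimage s (Homeomorph.subRight ε)
    intro x hx
    have hx' : x ∈ tsupport (s ∘ (Homeomorph.subRight ε)) := hx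
    rw [this] at hx'
    exact hs.2.2 hx'

theorem mul_mem_testSub_of_contDiffOn (hU : IsOpen U) (hh : ContDiffOn ℝ ∞ h U)
    (hs : s ∈ testSub U) : h * s ∈ testSub U := by
  refine ⟨?_, hs.2.1.mul_left, (tsupport_mul_subset_right).trans hs.2.2⟩
  rw [contDiff_iff_contDiffAt]
  intro x
  by_cases hx : x ∈ U
  · exact (hh.contDiffAt (hU.mem_nhds hx)).mul hs.1.contDiffAt
  · have hx' : x ∉ tsupport s := fun h' => hx (hs.2.2 h')
    have : (h * s) =ᶠ[𝓝 x] fun _ => (0 : ℂ) := by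
      filter_upwards [notMem_tsupport_iff_eventuallyEq.1 hx'] with y hy
      simp [hy]
    exact contDiffAt_const.congr_of_eventuallyEq this

theorem ofReal_mem_testSub {t : ℝ → ℝ} (ht : ContDiff ℝ ∞ t) (hc : HasCompactSupport t)
    (hU : tsupport t ⊆ U) : (fun x => (t x : ℂ)) ∈ testSub U :=
  ⟨Complex.ofRealCLM.contDiff.comp ht, hc.comp_left (g := fun x : ℝ => (x : ℂ)) (by simp),
    (closure_mono (Function.support_comp_subset (g := fun x : ℝ => (x : ℂ)) (by simp) t)).trans hU⟩

theorem _root_.TestFunction.mem_testSub (t : Test) (hU : tsupport t ⊆ U) : (fun x => (t x : ℂ)) ∈ testSub U :=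
  ofReal_mem_testSub t.contDiff t.hasCompactSupport hU

/-- The real part of a complex test function. -/
def reTest (s : testSub Set.univ) : Test where
  toFun x := (s.1 x).re
  contDiff' := Complex.reCLM.contDiff.comp s.2.1
  hasCompactSupport' := s.2.2.1.comp_left (g := Complex.re) rfl
  tsupport_subset' := fun _ _ => trivial

/-- The imaginary part of a complex test function. -/
def imTest (s : testSub Set.univ) : Test where
  toFun x := (s.1 x).im
  contDiff' := Complex.imCLM.contDiff.comp s.2.1
  hasCompactSupport' := s.2.2.1.comp_left (g := Complex.im) rfl
  tsupport_subset' := fun _ _ => trivial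

theorem reTest_apply (s : testSub Set.univ) (x : ℝ) : reTest s x = (s.1 x).re := rfl

theorem imTest_apply (s : testSub Set.univ) (x : ℝ) : imTest s x = (s.1 x).im := rfl

/-- The pairing of a distribution with complex test functions. -/
def cevSub (F : Dist) : testSub Set.univ →ₗ[ℂ] ℂ where
  toFun s := F (reTest s) + Complex.I * F (imTest s)
  map_add' s t := by
    have h1 : reTest (s + t) = reTest s + reTest t := by
      ext x; simp [reTest_apply]
    have h2 : imTest (s + t) = imTest s + imTest t := by
      ext x; simp [imTest_apply]
    rw [h1, h2, map_add, map_add]; ring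
  map_smul' c s := by
    have h1 : reTest (c • s) = c.re • reTest s - c.im • imTest s := by
      ext x; simp [reTest_apply, imTest_apply]
    have h2 : imTest (c • s) = c.re • imTest s + c.im • reTest s := by
      ext x; simp [reTest_apply, imTest_apply]
    rw [h1, h2, map_sub, map_add, map_smul, map_smul, map_smul, map_smul]
    simp only [Complex.real_smul, RingHom.id_apply, smul_eq_mul]
    conv_rhs => rw [← Complex.re_add_im c]
    linear_combination (-(c.im : ℂ) * F (imTest s)) * Complex.I_sq

/-- The pairing with complex test functions, extended linearly to all functions. -/
def cev (F : Dist) : (ℝ → ℂ) →ₗ[ℂ] ℂ := (cevSub F).exists_extend.choose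

theorem cev_coe (F : Dist) (s : testSub Set.univ) :
    cev F s = F (reTest s) + Complex.I * F (imTest s) :=
  LinearMap.congr_fun (cevSub F).exists_extend.choose_spec s

theorem cev_of_mem (F : Dist) (hs : s ∈ testSub Set.univ) :
    cev F s = F (reTest ⟨s, hs⟩) + Complex.I * F (imTest ⟨s, hs⟩) :=
  cev_coe F ⟨s, hs⟩

theorem cev_real (F : Dist) (t : Test) : cev F (fun x => (t x : ℂ)) = F t := by
  rw [cev_of_mem F (t.mem_testSub (Set.subset_univ _))]
  have h1 : reTest ⟨_, t.mem_testSub (Set.subset_univ _)⟩ = t := by ext x; simp [reTest_apply]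
  have h2 : imTest ⟨_, t.mem_testSub (Set.subset_univ _)⟩ = 0 := by ext x; simp [imTest_apply]
  rw [h1, h2]; simp

theorem dist_ext {F G : Dist} (h : ∀ s ∈ testSub Set.univ, cev F s = cev G s) : F = G := by
  refine DFunLike.ext _ _ fun t : Test => ?_
  rw [← cev_real, ← cev_real, h _ (t.mem_testSub (Set.subset_univ _))]

theorem cev_add_dist (F G : Dist) (hs : s ∈ testSub Set.univ) :
    cev (F + G) s = cev F s + cev G s := by
  have : ∀ t : Test, (F + G) t = F t + G t := fun _ => rfl
  simp only [cev_of_mem _ hs, this]; ring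

theorem cev_sub_dist (F G : Dist) (hs : s ∈ testSub Set.univ) :
    cev (F - G) s = cev F s - cev G s := by
  have : ∀ t : Test, (F - G) t = F t - G t := fun _ => rfl
  simp only [cev_of_mem _ hs, this]; ring

theorem cev_zero_dist (hs : s ∈ testSub Set.univ) : cev 0 s = 0 := by
  have : ∀ t : Test, (0 : Dist) t = 0 := fun _ => rfl
  simp only [cev_of_mem _ hs, this]; ring

theorem cev_smul_dist (c : ℂ) (F : Dist) (hs : s ∈ testSub Set.univ) :
    cev (c • F) s = c * cev F s := by
  have : ∀ t : Test, (c • F) t = c * F t := fun _ => rfl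
  simp only [cev_of_mem _ hs, this]; ring

theorem cev_sum_dist {ι : Type*} (I : Finset ι) (F : ι → Dist) (hs : s ∈ testSub Set.univ) :
    cev (∑ i ∈ I, F i) s = ∑ i ∈ I, cev (F i) s := by
  classical
  induction I using Finset.induction_on with
  | empty => simp [cev_zero_dist hs]
  | insert a I ha ih => rw [Finset.sum_insert ha, Finset.sum_insert ha, cev_add_dist _ _ hs, ih]

theorem testSub_integrable_mul (hs : s ∈ testSub Set.univ) (hf : LocallyIntegrable f) :
    Integrable fun x => s x * f x := by
  have := hf.integrable_smul_left_of_hasCompactSupport hs.1.continuous hs.2.1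
  simpa using this

theorem testSub_integrable_mul_on (hU : IsOpen U) (hs : s ∈ testSub U) (hf : ContinuousOn f U) :
    Integrable fun x => s x * f x := by
  have h1 : Continuous fun x => s x * f x := by
    rw [continuous_iff_continuousAt]
    intro x
    by_cases hx : x ∈ U
    · exact hs.1.continuous.continuousAt.mul (hf.continuousAt (hU.mem_nhds hx))
    · have hx' : x ∉ tsupport s := fun h' => hx (hs.2.2 h')
      have : (fun x => s x * f x) =ᶠ[𝓝 x] fun _ => (0 : ℂ) := by
        filter_upwards [notMem_tsupport_iff_eventuallyEq.1 hx'] with y hy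
        simp [hy]
      exact continuousAt_const.congr this.symm
  exact h1.integrable_of_hasCompactSupport (hs.2.1.mul_right)

theorem cev_regular (hf : LocallyIntegrable f) (hs : s ∈ testSub Set.univ) :
    cev (regular f) s = ∫ x, s x * f x := by
  have key : ∀ t : Test, regular f t = ∫ x, t x • f x := by
    intro t
    exact TestFunction.integralAgainstBilinCLM_eq_integral (hf.locallyIntegrableOn _)
  have hi : ∀ t : Test, Integrable fun x => t x • f x := fun t =>
    hf.integrable_smul_left_of_hasCompactSupport t.continuous t.hasCompactSupport
  rw [cev_of_mem _ hs, key, key, ← integral_const_mul, ← integral_add (hi _) ((hi _).const_mul _)]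
  congr 1; ext x
  rw [reTest_apply, imTest_apply, Complex.real_smul, Complex.real_smul]
  conv_rhs => rw [← Complex.re_add_im (s x)]
  ring

theorem cev_dirac (ξ : ℝ) (hs : s ∈ testSub Set.univ) : cev (dirac ξ) s = s ξ := by
  have key : ∀ t : Test, dirac ξ t = (t ξ : ℂ) := fun _ => rfl
  rw [cev_of_mem _ hs, key, key, reTest_apply, imTest_apply, mul_comm]
  exact Complex.re_add_im _

theorem cev_lineDeriv (F : Dist) (hs : s ∈ testSub Set.univ) :
    cev (∂_{(1 : ℝ)} F) s = - cev F (deriv s) := by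
  have key : ∀ t : Test, (∂_{(1 : ℝ)} F) t = - F (∂_{(1 : ℝ)} t) := by
    intro t; rw [Distribution.lineDerivOp_apply_apply, map_neg]
  rw [cev_of_mem _ hs, cev_of_mem _ (deriv_mem_testSub hs), key, key]
  have hd : ∀ x, HasDerivAt s (deriv s x) x := fun x =>
    ((hs.1.differentiable (by simp)) x).hasDerivAt
  have h1 : ∂_{(1 : ℝ)} (reTest ⟨s, hs⟩) = reTest ⟨deriv s, deriv_mem_testSub hs⟩ := by
    ext x
    rw [TestFunction.lineDerivOp_eq_lineDerivCLM (𝕜 := ℝ), TestFunction.lineDerivCLM_apply_of_le le_top]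
    have : HasDerivAt (fun x => (s x).re) (deriv s x).re x :=
      Complex.reCLM.hasFDerivAt.comp_hasDerivAt x (hd x)
    have h2 := this.hasFDerivAt.hasLineDerivAt 1
    rw [reTest_apply, ← one_smul ℝ (deriv s x).re]
    exact h2.lineDeriv
  have h2 : ∂_{(1 : ℝ)} (imTest ⟨s, hs⟩) = imTest ⟨deriv s, deriv_mem_testSub hs⟩ := by
    ext x
    rw [TestFunction.lineDerivOp_eq_lineDerivCLM (𝕜 := ℝ), TestFunction.lineDerivCLM_apply_of_le le_top]
    have : HasDerivAt (fun x => (s x).im) (deriv s x).im x :=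
      Complex.imCLM.hasFDerivAt.comp_hasDerivAt x (hd x)
    have h2 := this.hasFDerivAt.hasLineDerivAt 1
    rw [imTest_apply, ← one_smul ℝ (deriv s x).im]
    exact h2.lineDeriv
  rw [h1, h2]; ring

theorem D_zero (F : Dist) : D 0 F = F := rfl

theorem D_succ (k : ℕ) (F : Dist) : D (k + 1) F = ∂_{(1 : ℝ)} (D k F) :=
  Function.iterate_succ_apply' _ _ _

theorem D_D (m k : ℕ) (F : Dist) : D m (D k F) = D (m + k) F :=
  (Function.iterate_add_apply _ _ _ _).symm

theorem cev_D (k : ℕ) (F : Dist) (hs : s ∈ testSub Set.univ) :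
    cev (D k F) s = (-1) ^ k * cev F (iteratedDeriv k s) := by
  induction k generalizing s with
  | zero => simp [D_zero]
  | succ k ih =>
    rw [D_succ, cev_lineDeriv _ hs, ih (deriv_mem_testSub hs), iteratedDeriv_succ']; ring

theorem cev_translate (ε : ℝ) (F : Dist) (hs : s ∈ testSub Set.univ) :
    cev (translate ε F) s = cev F (fun x => s (x - ε)) := by
  have key : ∀ t : Test, translate ε F t = F (shiftTest ε t) := fun _ => rfl
  rw [cev_of_mem _ hs, cev_of_mem F (testSub_univ (shift_mem_testSub hs ε)), key, key]
  rfl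

theorem EqFunOn.cev {F : Dist} (hF : EqFunOn F f U) (hU : IsOpen U) (hf : ContinuousOn f U)
    (hs : s ∈ testSub U) : cev F s = ∫ x, s x * f x := by
  have hr : tsupport (reTest ⟨s, testSub_univ hs⟩) ⊆ U :=
    (closure_mono (Function.support_comp_subset (g := Complex.re) rfl s)).trans hs.2.2
  have hi : tsupport (imTest ⟨s, testSub_univ hs⟩) ⊆ U :=
    (closure_mono (Function.support_comp_subset (g := Complex.im) rfl s)).trans hs.2.2
  have hint : ∀ t : Test, tsupport t ⊆ U → Integrable fun x => t x • f x := by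
    intro t ht
    simpa using testSub_integrable_mul_on hU (t.mem_testSub ht) hf
  rw [cev_of_mem _ (testSub_univ hs), hF _ hr, hF _ hi, ← integral_const_mul,
    ← integral_add (hint _ hr) ((hint _ hi).const_mul _)]
  congr 1; ext x
  rw [reTest_apply, imTest_apply, Complex.real_smul, Complex.real_smul]
  conv_rhs => rw [← Complex.re_add_im (s x)]
  ring

theorem eqFunOn_of_cev {F : Dist} (h : ∀ s ∈ testSub U, Beam.cev F s = ∫ x, s x * f x) :
    EqFunOn F f U := by
  intro t ht
  rw [← cev_real, h _ (t.mem_testSub ht)]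
  simp

/-- In the complex pairing the split of `g t` into real and imaginary parts disappears, leaving the
usual `⟨P, s⟩ = ⟨G, g s⟩`. -/
theorem EqDualProductOn.cev {P G : Dist} (hP : EqDualProductOn P G g U) (hU : IsOpen U)
    (hg : ContDiffOn ℝ ∞ g U) (hs : s ∈ testSub U) : cev P s = cev G (g * s) := by
  have real_case : ∀ t : Test, tsupport t ⊆ U →
      P t = Beam.cev G (g * fun x => (t x : ℂ)) := by
    intro t ht
    have hm := testSub_univ (mul_mem_testSub_of_contDiffOn hU hg (t.mem_testSub ht))
    rw [cev_of_mem _ hm]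
    apply hP t _ _ ht
    · intro x; simp [reTest_apply]
    · intro x; simp [imTest_apply]
  have hr : tsupport (reTest ⟨s, testSub_univ hs⟩) ⊆ U :=
    (closure_mono (Function.support_comp_subset (g := Complex.re) rfl s)).trans hs.2.2
  have hi : tsupport (imTest ⟨s, testSub_univ hs⟩) ⊆ U :=
    (closure_mono (Function.support_comp_subset (g := Complex.im) rfl s)).trans hs.2.2
  rw [cev_of_mem _ (testSub_univ hs), real_case _ hr, real_case _ hi, ← smul_eq_mul Complex.I,
    ← map_smul, ← map_add]
  congr 1; ext x
  simp only [Pi.add_apply, Pi.mul_apply, Pi.smul_apply, reTest_apply, imTest_apply, smul_eq_mul]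
  conv_rhs => rw [← Complex.re_add_im (s x)]
  ring

theorem eqDualProductOn_of_cev {P G : Dist}
    (h : ∀ s ∈ testSub U, Beam.cev P s = Beam.cev G (g * s)) :
    EqDualProductOn P G g U := by
  intro t u v ht hu hv
  rw [← cev_real P, h _ (t.mem_testSub ht), ← cev_real G u, ← cev_real G v,
    ← smul_eq_mul Complex.I, ← map_smul, ← map_add]
  congr 1; ext x
  simp only [Pi.add_apply, Pi.mul_apply, Pi.smul_apply, hu, hv, smul_eq_mul]
  conv_lhs => rw [← Complex.re_add_im (g x)]
  push_cast; ring

end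

section

/-! ### Calculus of test functions -/

variable {U V : Set ℝ} {f g h s t u : ℝ → ℂ}

theorem hasDerivAt_of_contDiff (hs : ContDiff ℝ ∞ s) (x : ℝ) : HasDerivAt s (deriv s x) x :=
  ((hs.differentiable (by simp)) x).hasDerivAt

theorem deriv_mul_eq (hs : ContDiff ℝ ∞ s) (ht : ContDiff ℝ ∞ t) :
    deriv (s * t) = deriv s * t + s * deriv t := by
  ext x
  exact ((hasDerivAt_of_contDiff hs x).mul (hasDerivAt_of_contDiff ht x)).deriv

theorem deriv_add_eq (hs : ContDiff ℝ ∞ s) (ht : ContDiff ℝ ∞ t) :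
    deriv (s + t) = deriv s + deriv t := by
  ext x
  exact ((hasDerivAt_of_contDiff hs x).add (hasDerivAt_of_contDiff ht x)).deriv

theorem contDiff_deriv (hs : ContDiff ℝ ∞ s) : ContDiff ℝ ∞ (deriv s) :=
  (contDiff_infty_iff_deriv.1 hs).2

theorem exists_antideriv (hu : ContDiff ℝ ∞ u) :
    ∃ w : ℝ → ℂ, ContDiff ℝ ∞ w ∧ deriv w = u := by
  have hd : ∀ x, HasDerivAt (fun x => ∫ y in (0 : ℝ)..x, u y) (u x) x := fun x =>
    intervalIntegral.integral_hasDerivAt_right (hu.continuous.intervalIntegrable _ _)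
      (hu.continuous.stronglyMeasurableAtFilter _ _) hu.continuous.continuousAt
  have he : deriv (fun x => ∫ y in (0 : ℝ)..x, u y) = u := funext fun x => (hd x).deriv
  exact ⟨_, contDiff_infty_iff_deriv.2 ⟨fun x => (hd x).differentiableAt, by rwa [he]⟩, he⟩

theorem integral_deriv_mul (hs : s ∈ testSub Set.univ) (hf : ContDiff ℝ ∞ f) :
    ∫ x, deriv s x * f x = - ∫ x, s x * deriv f x := by
  have h0 : ∫ x, deriv (s * f) x = 0 :=
    integral_eq_zero_of_hasDerivAt_of_integrable
      (fun x => hasDerivAt_of_contDiff (hs.1.mul hf) x)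
      ((contDiff_deriv (hs.1.mul hf)).continuous.integrable_of_hasCompactSupport
        (HasCompactSupport.deriv hs.2.1.mul_right))
      ((hs.1.mul hf).continuous.integrable_of_hasCompactSupport hs.2.1.mul_right)
  rw [deriv_mul_eq hs.1 hf] at h0
  simp only [Pi.add_apply, Pi.mul_apply] at h0
  rw [integral_add (testSub_integrable_mul (deriv_mem_testSub hs) hf.continuous.locallyIntegrable)
    (testSub_integrable_mul hs (contDiff_deriv hf).continuous.locallyIntegrable)] at h0
  exact eq_neg_of_add_eq_zero_left h0

/-- Integrate from the left end `α` of the support. The primitive vanishes beyond the right end `β`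
because the total integral is zero, and `[α, β]` lies in `U` by order-connectedness. -/
theorem exists_testSub_deriv_eq (hU : U.OrdConnected) (hs : s ∈ testSub U)
    (h0 : ∫ x, s x = 0) : ∃ t ∈ testSub U, deriv t = s := by
  rcases (tsupport s).eq_empty_or_nonempty with he | hne
  · have : s = 0 := tsupport_eq_empty_iff.1 he
    exact ⟨0, zero_mem _, by rw [this]; ext x; simp⟩
  have hc : IsCompact (tsupport s) := hs.2.1
  obtain ⟨α, hα, hαl⟩ := hc.exists_isLeast hne
  obtain ⟨β, hβ, hβu⟩ := hc.exists_isGreatest hne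
  have hsub : Set.Icc α β ⊆ U := hU.out (hs.2.2 hα) (hs.2.2 hβ)
  have hcont := hs.1.continuous
  have hd : ∀ x, HasDerivAt (fun x => ∫ y in α..x, s y) (s x) x := fun x =>
    intervalIntegral.integral_hasDerivAt_right (hcont.intervalIntegrable _ _)
      (hcont.stronglyMeasurableAtFilter _ _) hcont.continuousAt
  have he : deriv (fun x => ∫ y in α..x, s y) = s := funext fun x => (hd x).deriv
  have hzl : ∀ x, x < α → s x = 0 := fun x hx =>
    image_eq_zero_of_notMem_tsupport fun h' => absurd (hαl h') (not_le.2 hx)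
  have hzr : ∀ x, β < x → s x = 0 := fun x hx =>
    image_eq_zero_of_notMem_tsupport fun h' => absurd (hβu h') (not_le.2 hx)
  have hαβ : α ≤ β := hαl hβ
  have hsupp : Function.support (fun x => ∫ y in α..x, s y) ⊆ Set.Icc α β := by
    intro x hx
    by_contra hx'
    apply hx
    rcases lt_or_ge x α with h1 | h1
    · change ∫ y in α..x, s y = 0
      rw [intervalIntegral.integral_symm, intervalIntegral.integral_of_le h1.le,
        integral_Ioc_eq_integral_Ioo,
        setIntegral_eq_zero_of_forall_eq_zero (fun y hy => hzl y hy.2), neg_zero]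
    · have h2 : β < x := by
        by_contra h3; exact hx' ⟨h1, not_lt.1 h3⟩
      change ∫ y in α..x, s y = 0
      rw [intervalIntegral.integral_of_le h1, integral_Ioc_eq_integral_Ioo, ← h0,
        ← integral_Icc_eq_integral_Ioo]
      apply setIntegral_eq_integral_of_forall_compl_eq_zero
      intro y hy
      rcases lt_or_ge y α with h3 | h3
      · exact hzl y h3
      · exact hzr y (h2.trans (by by_contra h4; exact hy ⟨h3, not_lt.1 h4⟩))
  have hts : tsupport (fun x => ∫ y in α..x, s y) ⊆ Set.Icc α β :=
    closure_minimal hsupp isClosed_Icc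
  refine ⟨_, ⟨contDiff_infty_iff_deriv.2 ⟨fun x => (hd x).differentiableAt, by rw [he]; exact hs.1⟩, ?_,
    hts.trans hsub⟩, he⟩
  exact isCompact_Icc.of_isClosed_subset (isClosed_tsupport _) hts

/-- `T` is linear on the test functions supported in `U`. -/
structure LinOn (U : Set ℝ) (T : (ℝ → ℂ) → ℂ) : Prop where
  add : ∀ s ∈ testSub U, ∀ t ∈ testSub U, T (s + t) = T s + T t
  smul : ∀ (c : ℂ), ∀ s ∈ testSub U, T (c • s) = c * T s

theorem exists_testSub_integral_eq_one (hU : IsOpen U) (hne : U.Nonempty) :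
    ∃ ρ ∈ testSub U, ∫ x, ρ x = 1 := by
  obtain ⟨x, hx⟩ := hne
  obtain ⟨r, hr, hrU⟩ := Metric.isOpen_iff.1 hU x hx
  let b : ContDiffBump x := ⟨r / 4, r / 2, by positivity, by linarith⟩
  refine ⟨fun y => (b.normed volume y : ℂ), ofReal_mem_testSub b.contDiff_normed
    b.hasCompactSupport_normed ?_, ?_⟩
  · rw [b.tsupport_normed_eq]
    exact (Metric.closedBall_subset_ball (by change r / 2 < r; linarith)).trans hrU
  · rw [integral_complex_ofReal, b.integral_normed]; simp

/-- `s - (∫ s) ρ` has integral zero, hence is the derivative of a test function and is killed by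
`T`; the constant is `T ρ`. Only linearity of `T` enters, so the weak theory below needs no
continuity. -/
theorem LinOn.eq_integral_of_deriv {T : (ℝ → ℂ) → ℂ} (hT : LinOn U T) (hU : U.OrdConnected)
    (hUo : IsOpen U) (hne : U.Nonempty) (h : ∀ t ∈ testSub U, T (deriv t) = 0) :
    ∃ κ : ℂ, ∀ s ∈ testSub U, T s = κ * ∫ x, s x := by
  obtain ⟨ρ, hρ, hρ1⟩ := exists_testSub_integral_eq_one hUo hne
  refine ⟨T ρ, fun s hs => ?_⟩
  have hint : ∀ s ∈ testSub U, Integrable s := fun s hs =>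
    hs.1.continuous.integrable_of_hasCompactSupport hs.2.1
  have hmem : s + (-(∫ x, s x)) • ρ ∈ testSub U := add_mem hs (Submodule.smul_mem _ _ hρ)
  obtain ⟨t, ht, hts⟩ := exists_testSub_deriv_eq hU hmem (by
    simp only [Pi.add_apply, Pi.smul_apply, smul_eq_mul]
    rw [integral_add (hint s hs) ((hint ρ hρ).const_mul _), integral_const_mul, hρ1]; ring)
  have := h t ht
  rw [hts, hT.add _ hs _ (Submodule.smul_mem _ _ hρ), hT.smul _ _ hρ] at this
  linear_combination this

theorem LinOn.sub_integral {T : (ℝ → ℂ) → ℂ} (hT : LinOn U T) {w : ℝ → ℂ} (hw : Continuous w) :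
    LinOn U fun s => T s - ∫ x, s x * w x where
  add s hs t ht := by
    simp only [Pi.add_apply, add_mul]
    rw [hT.add _ hs _ ht, integral_add
      (testSub_integrable_mul (testSub_univ hs) hw.locallyIntegrable)
      (testSub_integrable_mul (testSub_univ ht) hw.locallyIntegrable)]
    ring
  smul c s hs := by
    simp only [Pi.smul_apply, smul_eq_mul, mul_assoc]
    rw [hT.smul _ _ hs, integral_const_mul]; ring

/-- Subtracting the pairing with some antiderivative of `u` leaves a functional that kills
derivatives, so `T` differs from it by a constant of integration. -/
theorem LinOn.exists_antideriv {T : (ℝ → ℂ) → ℂ} (hT : LinOn U T) (hU : U.OrdConnected)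
    (hUo : IsOpen U) (hne : U.Nonempty) (hu : ContDiff ℝ ∞ u)
    (h : ∀ t ∈ testSub U, T (deriv t) = - ∫ x, t x * u x) :
    ∃ w : ℝ → ℂ, ContDiff ℝ ∞ w ∧ deriv w = u ∧ ∀ s ∈ testSub U, T s = ∫ x, s x * w x := by
  obtain ⟨w, hw, hwu⟩ := Beam.exists_antideriv hu
  obtain ⟨κ, hκ⟩ := (hT.sub_integral hw.continuous).eq_integral_of_deriv hU hUo hne (fun t ht => by
    rw [h t ht, integral_deriv_mul (testSub_univ ht) hw, hwu]; ring)
  refine ⟨w + fun _ => κ, hw.add contDiff_const, ?_, fun s hs => ?_⟩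
  · rw [deriv_add_eq hw contDiff_const, hwu]; ext x; simp
  · have h1 := hκ s hs
    simp only [Pi.add_apply, mul_add]
    rw [integral_add (testSub_integrable_mul (testSub_univ hs) hw.continuous.locallyIntegrable)
      ((hs.1.continuous.integrable_of_hasCompactSupport hs.2.1).mul_const _), integral_mul_const]
    linear_combination h1

theorem exists_testSub_partition {d : ℕ} (Ξ : Fin d → Set ℝ) (ho : ∀ i, IsOpen (Ξ i))
    (hc : (⋃ i, Ξ i) = Set.univ) (hs : s ∈ testSub U) :
    ∃ σ : Fin d → ℝ → ℂ, (∀ i, σ i ∈ testSub (U ∩ Ξ i)) ∧ s = ∑ i, σ i := by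
  obtain ⟨p, hp⟩ := SmoothPartitionOfUnity.exists_isSubordinate (modelWithCornersSelf ℝ ℝ)
    (isClosed_univ (X := ℝ)) Ξ ho hc.ge
  have hsm : ∀ i, ContDiff ℝ ∞ fun x => (p i x : ℂ) := fun i =>
    Complex.ofRealCLM.contDiff.comp (p i).contMDiff.contDiff
  refine ⟨fun i => (fun x => (p i x : ℂ)) * s, fun i => ?_, ?_⟩
  · refine ⟨(hsm i).mul hs.1, hs.2.1.mul_left, Set.subset_inter
      ((tsupport_mul_subset_right).trans hs.2.2) ((tsupport_mul_subset_left).trans ?_)⟩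
    exact (closure_mono (Function.support_comp_subset (g := fun x : ℝ => (x : ℂ)) (by simp)
      (p i))).trans (hp i)
  · ext x
    have h1 : ∑ i, p i x = 1 := by
      rw [← finsum_eq_sum_of_fintype]; exact p.sum_eq_one (Set.mem_univ x)
    have h2 : ∑ i, (p i x : ℂ) = 1 := by exact_mod_cast h1
    simp only [Finset.sum_apply, Pi.mul_apply]
    rw [← Finset.sum_mul, h2, one_mul]

/-- Joint smoothness in the parameter and the variable supplies the uniform bounds and continuity
needed for the limits `ε ↓ 0`. -/
theorem contDiff_iteratedDeriv_snd {S : ℝ × ℝ → ℂ} (hS : ContDiff ℝ ∞ S) (k : ℕ) :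
    ContDiff ℝ ∞ fun p : ℝ × ℝ => iteratedDeriv k (fun x => S (p.1, x)) p.2 := by
  induction k generalizing S with
  | zero => simpa using hS
  | succ k ih =>
    have h1 : ContDiff ℝ ∞ fun p : ℝ × ℝ => fderiv ℝ S p (0, 1) :=
      (hS.fderiv_right (m := ∞) (by simp)).clm_apply contDiff_const
    have h2 : ∀ ε : ℝ, (fun x => fderiv ℝ S (ε, x) (0, 1)) = deriv fun x => S (ε, x) := by
      intro ε; ext x
      have h3 : HasDerivAt (fun x : ℝ => (ε, x)) ((0 : ℝ), (1 : ℝ)) x :=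
        (hasDerivAt_const x ε).prodMk (hasDerivAt_id x)
      exact (((hS.differentiable (by simp)) (ε, x)).hasFDerivAt.comp_hasDerivAt x h3).deriv.symm
    have := ih h1
    simpa only [h2, iteratedDeriv_succ'] using this

theorem contDiff_slice {S : ℝ × ℝ → ℂ} (hS : ContDiff ℝ ∞ S) (ε : ℝ) :
    ContDiff ℝ ∞ fun x => S (ε, x) := hS.comp (contDiff_const.prodMk contDiff_id)

/-- All derivatives are moved onto `S`; they are bounded on `[0, 1] × K`, so dominated convergence
applies. This takes the place of continuity of a general distribution along a converging family of
test functions. -/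
theorem tendsto_cev_D_regular (hf : LocallyIntegrable f) (k : ℕ) {S : ℝ × ℝ → ℂ}
    (hS : ContDiff ℝ ∞ S) {K : Set ℝ} (hK : IsCompact K)
    (hSK : ∀ ε ∈ Set.Icc (0 : ℝ) 1, tsupport (fun x => S (ε, x)) ⊆ K) :
    Tendsto (fun ε => cev (D k (regular f)) fun x => S (ε, x)) (𝓝[>] 0)
      (𝓝 (cev (D k (regular f)) fun x => S (0, x))) := by
  have hmem : ∀ ε ∈ Set.Icc (0 : ℝ) 1, (fun x => S (ε, x)) ∈ testSub Set.univ := fun ε hε =>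
    ⟨contDiff_slice hS ε, hK.of_isClosed_subset (isClosed_tsupport _) (hSK ε hε),
      Set.subset_univ _⟩
  have hev : ∀ ε ∈ Set.Icc (0 : ℝ) 1, cev (D k (regular f)) (fun x => S (ε, x)) =
      (-1) ^ k * ∫ x, iteratedDeriv k (fun x => S (ε, x)) x * f x := fun ε hε => by
    rw [cev_D _ _ (hmem ε hε), cev_regular hf (iteratedDeriv_mem_testSub (hmem ε hε) k)]
  rw [hev 0 (by simp)]
  have hnear : Set.Ioc (0 : ℝ) 1 ∈ 𝓝[>] (0 : ℝ) := Ioc_mem_nhdsGT one_pos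
  refine Tendsto.congr' (f₁ := fun ε => (-1) ^ k * ∫ x, iteratedDeriv k (fun x => S (ε, x)) x * f x)
    ?_ (Tendsto.const_mul _ ?_)
  · filter_upwards [hnear] with ε hε
    exact (hev ε ⟨hε.1.le, hε.2⟩).symm
  have hcont := (contDiff_iteratedDeriv_snd hS k).continuous
  obtain ⟨C, hC⟩ := ((isCompact_Icc (a := (0 : ℝ)) (b := 1)).prod hK).exists_bound_of_continuousOn
    hcont.continuousOn
  have hzero : ∀ ε ∈ Set.Icc (0 : ℝ) 1, ∀ x ∉ K, iteratedDeriv k (fun x => S (ε, x)) x = 0 := by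
    intro ε hε x hx
    apply image_eq_zero_of_notMem_tsupport
    intro h'
    refine hx (hSK ε hε ?_)
    have : ∀ j, tsupport (iteratedDeriv j fun x => S (ε, x)) ⊆ tsupport fun x => S (ε, x) := by
      intro j
      induction j with
      | zero => simp
      | succ j ih => rw [iteratedDeriv_succ]; exact (tsupport_deriv_subset (𝕜 := ℝ)).trans ih
    exact this k h'
  refine tendsto_integral_filter_of_dominated_convergence
    (K.indicator fun x => C * ‖f x‖) ?_ ?_ ?_ ?_
  · filter_upwards [hnear] with ε hε
    exact (testSub_integrable_mul
      (iteratedDeriv_mem_testSub (hmem ε ⟨hε.1.le, hε.2⟩) k) hf).aestronglyMeasurable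
  · filter_upwards [hnear] with ε hε
    refine Eventually.of_forall fun x => ?_
    have hε' : ε ∈ Set.Icc (0 : ℝ) 1 := ⟨hε.1.le, hε.2⟩
    by_cases hx : x ∈ K
    · rw [Set.indicator_of_mem hx, norm_mul]
      exact mul_le_mul_of_nonneg_right (hC (ε, x) ⟨hε', hx⟩) (norm_nonneg _)
    · rw [Set.indicator_of_notMem hx, hzero ε hε' x hx]; simp
  · rw [integrable_indicator_iff hK.measurableSet]
    exact ((hf.integrableOn_isCompact hK).norm).const_mul C
  · refine Eventually.of_forall fun x => Tendsto.mul_const _ ?_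
    have : Continuous fun ε : ℝ => iteratedDeriv k (fun x => S (ε, x)) x :=
      hcont.comp (continuous_id.prodMk continuous_const)
    exact (this.tendsto 0).mono_left nhdsWithin_le_nhds

end

section

/-! ### Hörmander products and star products -/

variable {U V : Set ℝ} {f g h s t u : ℝ → ℂ} {F G P Q : Dist}

theorem eqOn_of_eqFunOn (hU : IsOpen U) (hf : ContinuousOn f U) (hg : ContinuousOn g U)
    (h1 : EqFunOn F f U) (h2 : EqFunOn F g U) : Set.EqOn f g U := by
  have hz := hU.ae_eq_zero_of_integral_contDiff_smul_eq_zero (μ := volume) (f := f - g)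
    ((hf.sub hg).locallyIntegrableOn hU.measurableSet) (fun t ht hc htU => by
      have hm := ofReal_mem_testSub ht hc htU
      have e1 := h1.cev hU hf hm
      have e2 := h2.cev hU hg hm
      have hi1 := testSub_integrable_mul_on hU hm hf
      have hi2 := testSub_integrable_mul_on hU hm hg
      calc ∫ x, t x • (f - g) x = ∫ x, ((t x : ℂ) * f x - (t x : ℂ) * g x) := by
            congr 1; ext x; simp [mul_sub]
        _ = 0 := by rw [integral_sub hi1 hi2, ← e1, ← e2, sub_self])
  refine Measure.eqOn_open_of_ae_eq (μ := volume) ?_ hU hf hg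
  rw [Filter.EventuallyEq, ae_restrict_iff' hU.measurableSet]
  filter_upwards [hz] with x hx hxU
  exact sub_eq_zero.1 (hx hxU)

theorem IsHormanderProduct.symm (hP : IsHormanderProduct F G P) : IsHormanderProduct G F P := by
  obtain ⟨d, Ξ, ho, hc, hΞ⟩ := hP
  refine ⟨d, Ξ, ho, hc, fun i => ?_⟩
  obtain ⟨g, hg, hor⟩ := hΞ i
  exact ⟨g, hg, hor.symm⟩

/-- The product does not depend on the cover in its definition. Split `s` along the cover: where the
first factor is the smooth one, its representative agrees with `h` on the overlap; where the second
is, both sides equal `∫ s g h`. -/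
theorem IsHormanderProduct.cev_eq (hP : IsHormanderProduct F G P) (hU : IsOpen U)
    (hh : ContDiffOn ℝ ∞ h U) (hF : EqFunOn F h U) (hs : s ∈ testSub U) :
    cev P s = cev G (h * s) := by
  obtain ⟨d, Ξ, ho, hc, hΞ⟩ := hP
  obtain ⟨σ, hσ, rfl⟩ := exists_testSub_partition Ξ ho hc hs
  rw [Finset.mul_sum, map_sum, map_sum]
  refine Finset.sum_congr rfl fun i _ => ?_
  obtain ⟨g, hg, hor⟩ := hΞ i
  have hσU : σ i ∈ testSub U := testSub_mono Set.inter_subset_left (hσ i)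
  have hσΞ : σ i ∈ testSub (Ξ i) := testSub_mono Set.inter_subset_right (hσ i)
  rcases hor with ⟨hFg, hPG⟩ | ⟨hGg, hPF⟩
  · rw [hPG.cev (ho i) hg hσΞ]
    congr 1; ext x
    by_cases hx : x ∈ tsupport (σ i)
    · have := eqOn_of_eqFunOn (F := F) (hU.inter (ho i))
        (hg.continuousOn.mono Set.inter_subset_right)
        (hh.continuousOn.mono Set.inter_subset_left)
        (fun t ht => hFg t (ht.trans Set.inter_subset_right))
        (fun t ht => hF t (ht.trans Set.inter_subset_left)) ((hσ i).2.2 hx)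
      simp [this]
    · simp [image_eq_zero_of_notMem_tsupport hx]
  · rw [hPF.cev (ho i) hg hσΞ]
    have m1 : g * σ i ∈ testSub U :=
      ⟨(mul_mem_testSub_of_contDiffOn (ho i) hg hσΞ).1, hσU.2.1.mul_left,
        (tsupport_mul_subset_right).trans hσU.2.2⟩
    have m2 : h * σ i ∈ testSub (Ξ i) :=
      ⟨(mul_mem_testSub_of_contDiffOn hU hh hσU).1, hσU.2.1.mul_left,
        (tsupport_mul_subset_right).trans hσΞ.2.2⟩
    rw [hF.cev hU hh.continuousOn m1, hGg.cev (ho i) hg.continuousOn m2]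
    congr 1; ext x; simp only [Pi.mul_apply]; ring

theorem IsHormanderProduct.unique (hP : IsHormanderProduct F G P)
    (hQ : IsHormanderProduct F G Q) : P = Q := by
  refine dist_ext fun s hs => ?_
  obtain ⟨d, Ξ, ho, hc, hΞ⟩ := hQ
  obtain ⟨σ, hσ, rfl⟩ := exists_testSub_partition Ξ ho hc hs
  rw [map_sum, map_sum]
  refine Finset.sum_congr rfl fun i _ => ?_
  obtain ⟨g, hg, hor⟩ := hΞ i
  have hσΞ : σ i ∈ testSub (Ξ i) := testSub_mono Set.inter_subset_right (hσ i)
  rcases hor with ⟨hFg, hQG⟩ | ⟨hGg, hQF⟩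
  · rw [hQG.cev (ho i) hg hσΞ, hP.cev_eq (ho i) hg hFg hσΞ]
  · rw [hQF.cev (ho i) hg hσΞ, hP.symm.cev_eq (ho i) hg hGg hσΞ]

theorem tendsto_cev {Q : ℝ → Dist} (hQ : ∀ t : Test, Tendsto (fun ε => Q ε t) (𝓝[>] (0 : ℝ))
    (𝓝 (P t))) (hs : s ∈ testSub Set.univ) :
    Tendsto (fun ε => cev (Q ε) s) (𝓝[>] (0 : ℝ)) (𝓝 (cev P s)) := by
  simp only [cev_of_mem _ hs]
  exact (hQ _).add ((hQ _).const_mul _)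

theorem IsStarProduct.unique (hP : IsStarProduct F G P) (hQ : IsStarProduct F G Q) : P = Q := by
  obtain ⟨P', hP', hPl⟩ := hP
  obtain ⟨Q', hQ', hQl⟩ := hQ
  refine dist_ext fun s hs => tendsto_nhds_unique (tendsto_cev hPl hs)
    ((tendsto_cev hQl hs).congr' ?_)
  filter_upwards [hP', hQ'] with ε h1 h2
  rw [h1.unique h2]

theorem eqFunOn_translate (hU : IsOpen U) (hh : ContinuousOn h U) (hG : EqFunOn G h U) (ε : ℝ) :
    EqFunOn (translate ε G) (fun x => h (x + ε)) ((fun x => x + ε) ⁻¹' U) := by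
  refine eqFunOn_of_cev fun s hs => ?_
  have hm : (fun x => s (x - ε)) ∈ testSub U := by
    refine testSub_mono ?_ (shift_mem_testSub hs ε)
    intro x hx; simpa using hx
  rw [cev_translate _ _ (testSub_univ hs), hG.cev hU hh hm,
    ← integral_sub_right_eq_self (fun x => s x * h (x + ε)) ε]
  simp

/-- Derivatives of locally integrable functions. -/
def derivLocInt : Set Dist := {F | ∃ (k : ℕ) (f : ℝ → ℂ), LocallyIntegrable f ∧ F = D k (regular f)}

/-- The translation goes onto the test function: for each small `ε` the product pairs with `s` as
`⟨G, (h s)(· - ε)⟩`. This shifted function may leave `U`, which is harmless because `G` is defined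
on all of `ℝ`. -/
theorem IsStarProduct.cev_of_left (hP : IsStarProduct F G P) (hG : G ∈ derivLocInt)
    (hU : IsOpen U) (hh : ContDiff ℝ ∞ h) (hF : EqFunOn F h U) (hs : s ∈ testSub U) :
    cev P s = cev G (h * s) := by
  obtain ⟨k, g, hg, rfl⟩ := hG
  obtain ⟨Q, hQ, hQl⟩ := hP
  have hm : h * s ∈ testSub U := mul_mem_testSub hh hs
  have hS : ContDiff ℝ ∞ fun p : ℝ × ℝ => (h * s) (p.2 - p.1) :=
    hm.1.comp (contDiff_snd.sub contDiff_fst)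
  have hK : IsCompact ((fun p : ℝ × ℝ => p.1 + p.2) '' (tsupport (h * s) ×ˢ Set.Icc (0 : ℝ) 1)) :=
    (IsCompact.prod hm.2.1 isCompact_Icc).image (by fun_prop)
  have hlim := tendsto_cev_D_regular hg k hS hK (fun ε hε x hx => by
    have h1 : h * s ∈ testSub (tsupport (h * s)) := ⟨hm.1, hm.2.1, subset_rfl⟩
    have h2 := (shift_mem_testSub h1 ε).2.2 hx
    exact ⟨(x - ε, ε), ⟨h2, hε⟩, by simp⟩)
  simp only [sub_zero] at hlim
  refine tendsto_nhds_unique ((tendsto_cev hQl (testSub_univ hs)).congr' ?_) hlim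
  filter_upwards [hQ] with ε hε
  rw [hε.cev_eq hU hh.contDiffOn hF hs, cev_translate _ _ (testSub_univ hm)]

/-- Here the translated factor is smooth only on `U - ε`, so `ε` has to be smaller than a radius `δ`
for which the `δ`-neighbourhood of the support of `s` stays in `U`. -/
theorem IsStarProduct.cev_of_right (hP : IsStarProduct F G P) (hF : F ∈ derivLocInt)
    (hU : IsOpen U) (hh : ContDiff ℝ ∞ h) (hG : EqFunOn G h U) (hs : s ∈ testSub U) :
    cev P s = cev F (h * s) := by
  obtain ⟨k, f, hf, rfl⟩ := hF
  obtain ⟨Q, hQ, hQl⟩ := hP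
  have hS : ContDiff ℝ ∞ fun p : ℝ × ℝ => h (p.2 + p.1) * s p.2 :=
    (hh.comp (contDiff_snd.add contDiff_fst)).mul (hs.1.comp contDiff_snd)
  have hlim := tendsto_cev_D_regular hf k hS (K := tsupport s) hs.2.1
    (fun ε hε => tsupport_mul_subset_right)
  simp only [add_zero] at hlim
  refine tendsto_nhds_unique ((tendsto_cev hQl (testSub_univ hs)).congr' ?_) hlim
  obtain ⟨δ, hδ, hδU⟩ := IsCompact.exists_thickening_subset_open hs.2.1 hU hs.2.2
  filter_upwards [hQ, Ioo_mem_nhdsGT hδ] with ε hε hεδ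
  have hm : s ∈ testSub ((fun x => x + ε) ⁻¹' U) := ⟨hs.1, hs.2.1, fun x hx => hδU (by
    rw [Metric.mem_thickening_iff]
    exact ⟨x, hx, by simpa [abs_of_pos hεδ.1] using hεδ.2⟩)⟩
  exact hε.symm.cev_eq (hU.preimage (by fun_prop)) (hh.comp (contDiff_id.add contDiff_const)).contDiffOn
    (eqFunOn_translate hU hh.continuous.continuousOn hG ε) hm

end

section

/-! ### Distributions with one singular point -/

open Polynomial in
/-- The pairing of the point distribution `∑ c_j δ_ξ^{(j)}`, encoded by the polynomial
`∑ c_j X^j`, with a smooth function. -/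
def deltaPair (ξ : ℝ) (s : ℝ → ℂ) : ℂ[X] →ₗ[ℂ] ℂ :=
  Polynomial.lsum fun j => ((-1) ^ j * iteratedDeriv j s ξ) • LinearMap.id

variable {U V : Set ℝ} {f g h s t u fm fp gm gp : ℝ → ℂ} {F G P Q : Dist} {ξ : ℝ}

section deltaPair

open Polynomial

variable {p q : ℂ[X]}

theorem deltaPair_apply (ξ : ℝ) (s : ℝ → ℂ) (p : ℂ[X]) :
    deltaPair ξ s p = ∑ j ∈ p.support, (-1) ^ j * iteratedDeriv j s ξ * p.coeff j := by
  simp [deltaPair, Polynomial.lsum_apply, Polynomial.sum_def]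

theorem deltaPair_monomial (ξ : ℝ) (s : ℝ → ℂ) (j : ℕ) (c : ℂ) :
    deltaPair ξ s (monomial j c) = (-1) ^ j * iteratedDeriv j s ξ * c := by
  simp [deltaPair, Polynomial.lsum_apply, Polynomial.sum_monomial_index]

theorem deltaPair_C (ξ : ℝ) (s : ℝ → ℂ) (c : ℂ) : deltaPair ξ s (C c) = c * s ξ := by
  rw [← monomial_zero_left, deltaPair_monomial]; simp [mul_comm]

/-- In the polynomial encoding, multiplication by `X` is the distributional derivative. -/
theorem deltaPair_X_mul (ξ : ℝ) (s : ℝ → ℂ) (p : ℂ[X]) :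
    deltaPair ξ s (X * p) = - deltaPair ξ (deriv s) p := by
  induction p using Polynomial.induction_on' with
  | add p q hp hq => rw [mul_add, map_add, hp, hq, map_add]; ring
  | monomial n a =>
    rw [X_mul_monomial, deltaPair_monomial, deltaPair_monomial, iteratedDeriv_succ']; ring

theorem deltaPair_congr (h : s =ᶠ[𝓝 ξ] t) : deltaPair ξ s = deltaPair ξ t := by
  ext1 j; ext
  simp [deltaPair_monomial, h.iteratedDeriv_eq]

theorem deltaPair_eq_zero (h : ξ ∉ tsupport s) (p : ℂ[X]) : deltaPair ξ s p = 0 := by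
  rw [deltaPair_congr (t := fun _ => 0) (notMem_tsupport_iff_eventuallyEq.1 h), deltaPair_apply]
  refine Finset.sum_eq_zero fun j _ => ?_
  have : iteratedDeriv j (fun _ : ℝ => (0 : ℂ)) ξ = 0 := by simp
  rw [this]; simp

theorem deltaPair_shift (ξ ε : ℝ) (s : ℝ → ℂ) (p : ℂ[X]) :
    deltaPair ξ (fun x => s (x - ε)) p = deltaPair (ξ - ε) s p := by
  simp [deltaPair_apply, iteratedDeriv_comp_sub_const]

theorem continuous_deltaPair {S : ℝ × ℝ → ℂ} (hS : ContDiff ℝ ∞ S) (p : ℂ[X]) :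
    Continuous fun z : ℝ × ℝ => deltaPair z.2 (fun x => S (z.1, x)) p := by
  simp only [deltaPair_apply]
  exact continuous_finsetSum _ fun j _ =>
    (continuous_const.mul (contDiff_iteratedDeriv_snd hS j).continuous).mul continuous_const

/-- The functional is continuous because it is assembled from Dirac measures by `h δ^{(n+1)} = (h
δ^{(n)})' - h' δ^{(n)}`, by induction on the order. -/
theorem exists_dist_deltaPair (ξ : ℝ) (hh : ContDiff ℝ ∞ h) (p : ℂ[X]) :
    ∃ T : Dist, ∀ s ∈ testSub Set.univ, cev T s = deltaPair ξ (h * s) p := by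
  induction p using Polynomial.induction_on' with
  | add p q hp hq =>
    obtain ⟨T, hT⟩ := hp
    obtain ⟨T', hT'⟩ := hq
    exact ⟨T + T', fun s hs => by rw [cev_add_dist _ _ hs, hT s hs, hT' s hs, map_add]⟩
  | monomial n a =>
    induction n generalizing h with
    | zero =>
      refine ⟨(a * h ξ) • dirac ξ, fun s hs => ?_⟩
      rw [cev_smul_dist _ _ hs, cev_dirac _ hs, deltaPair_monomial]
      simp; ring
    | succ n ih =>
      obtain ⟨T, hT⟩ := ih hh
      obtain ⟨T', hT'⟩ := ih (contDiff_deriv hh)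
      refine ⟨∂_{(1 : ℝ)} T - T', fun s hs => ?_⟩
      rw [cev_sub_dist _ _ hs, cev_lineDeriv _ hs, hT _ (deriv_mem_testSub hs), hT' _ hs,
        ← X_mul_monomial, deltaPair_X_mul, deriv_mul_eq hh hs.1, deltaPair_monomial,
        deltaPair_monomial, deltaPair_monomial, iteratedDeriv_add]
      · ring
      · exact ((contDiff_deriv hh).mul hs.1).contDiffAt.of_le (by exact_mod_cast le_top)
      · exact (hh.mul (contDiff_deriv hs.1)).contDiffAt.of_le (by exact_mod_cast le_top)

end deltaPair

/-! ### Functions with two smooth branches -/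

/-- The function that is `fm` to the left and `fp` to the right of `ξ`. -/
def pw (ξ : ℝ) (fm fp : ℝ → ℂ) (x : ℝ) : ℂ :=
  fm x * heaviside (ξ - x) + fp x * heaviside (x - ξ)

theorem pw_left {x : ℝ} (hx : x < ξ) : pw ξ fm fp x = fm x := by
  simp [pw, heaviside, hx, hx.le]

theorem pw_right {x : ℝ} (hx : ξ < x) : pw ξ fm fp x = fp x := by
  simp [pw, heaviside, hx, hx.le]

theorem pw_self : pw ξ fm fp ξ = 0 := by simp [pw, heaviside]

theorem pw_mul_pw (x : ℝ) : pw ξ fm fp x * pw ξ gm gp x = pw ξ (fm * gm) (fp * gp) x := by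
  rcases lt_trichotomy x ξ with hx | rfl | hx
  · simp [pw_left hx]
  · simp [pw_self]
  · simp [pw_right hx]

theorem norm_pw_le (x : ℝ) : ‖pw ξ fm fp x‖ ≤ ‖fm x‖ + ‖fp x‖ := by
  rcases lt_trichotomy x ξ with hx | rfl | hx
  · simp [pw_left hx]
  · rw [pw_self, norm_zero]; positivity
  · simp [pw_right hx]

theorem measurable_pw (hm : Continuous fm) (hp : Continuous fp) : Measurable (pw ξ fm fp) := by
  have hH : Measurable heaviside := Measurable.ite measurableSet_Ioi measurable_const measurable_const
  exact (hm.measurable.mul (hH.comp (measurable_const.sub measurable_id))).add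
    (hp.measurable.mul (hH.comp (measurable_id.sub measurable_const)))

theorem locallyIntegrable_pw (hm : Continuous fm) (hp : Continuous fp) :
    LocallyIntegrable (pw ξ fm fp) := by
  refine LocallyIntegrable.mono (f := fun x => ‖fm x‖ + ‖fp x‖)
    (hm.norm.add hp.norm).locallyIntegrable
    (measurable_pw hm hp).aestronglyMeasurable (Eventually.of_forall fun x => ?_)
  rw [Real.norm_of_nonneg (by positivity)]
  exact norm_pw_le x

theorem locallyIntegrable_pw_mul_shift (hfm : Continuous fm) (hfp : Continuous fp)
    (hgm : Continuous gm) (hgp : Continuous gp) (ε : ℝ) :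
    LocallyIntegrable fun x => pw ξ fm fp x * pw ξ gm gp (x + ε) := by
  refine LocallyIntegrable.mono
    (f := fun x => (‖fm x‖ + ‖fp x‖) * (‖gm (x + ε)‖ + ‖gp (x + ε)‖))
    (Continuous.locallyIntegrable (by fun_prop))
    ((measurable_pw hfm hfp).mul ((measurable_pw hgm hgp).comp
      (measurable_id.add measurable_const))).aestronglyMeasurable
    (Eventually.of_forall fun x => ?_)
  rw [Real.norm_of_nonneg (by positivity), norm_mul]
  exact mul_le_mul (norm_pw_le x) (norm_pw_le _) (norm_nonneg _) (by positivity)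

theorem integral_mul_pw (hm : Continuous fm) (hp : Continuous fp) (hs : s ∈ testSub Set.univ) :
    ∫ x, s x * pw ξ fm fp x = (∫ x in Set.Iic ξ, s x * fm x) + ∫ x in Set.Ioi ξ, s x * fp x := by
  rw [← intervalIntegral.integral_Iic_add_Ioi (b := ξ)
    (testSub_integrable_mul hs (locallyIntegrable_pw hm hp)).integrableOn
    (testSub_integrable_mul hs (locallyIntegrable_pw hm hp)).integrableOn]
  congr 1
  · rw [integral_Iic_eq_integral_Iio, integral_Iic_eq_integral_Iio]
    exact setIntegral_congr_fun measurableSet_Iio fun x hx => by simp only [pw_left hx]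
  · exact setIntegral_congr_fun measurableSet_Ioi fun x hx => by simp only [pw_right hx]

/-- Integration by parts on each half-line; the two boundary terms at `ξ` combine to the jump. -/
theorem integral_deriv_mul_pw (hm : ContDiff ℝ ∞ fm) (hp : ContDiff ℝ ∞ fp)
    (hs : s ∈ testSub Set.univ) :
    ∫ x, deriv s x * pw ξ fm fp x =
      - (fp ξ - fm ξ) * s ξ - ∫ x, s x * pw ξ (deriv fm) (deriv fp) x := by
  have hds := deriv_mem_testSub hs
  have hsplit : ∀ (k : ℝ → ℂ), ContDiff ℝ ∞ k → ∀ A : Set ℝ,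
      ∫ x in A, deriv (s * k) x = (∫ x in A, deriv s x * k x) + ∫ x in A, s x * deriv k x := by
    intro k hk A
    rw [deriv_mul_eq hs.1 hk]
    exact integral_add (testSub_integrable_mul hds hk.continuous.locallyIntegrable).integrableOn
      (testSub_integrable_mul hs (contDiff_deriv hk).continuous.locallyIntegrable).integrableOn
  have h1 := HasCompactSupport.integral_Iic_deriv_eq (f := s * fm) ((hs.1.mul hm).of_le (by simp))
    hs.2.1.mul_right ξ
  have h2 := HasCompactSupport.integral_Ioi_deriv_eq (f := s * fp) ((hs.1.mul hp).of_le (by simp))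
    hs.2.1.mul_right ξ
  rw [hsplit _ hm] at h1
  rw [hsplit _ hp] at h2
  rw [integral_mul_pw hm.continuous hp.continuous hds,
    integral_mul_pw (contDiff_deriv hm).continuous (contDiff_deriv hp).continuous hs]
  simp only [Pi.mul_apply] at h1 h2
  linear_combination h1 + h2

open Polynomial in
/-- `F` is the sum of the regular distribution of `pw ξ fm fp` and of the point distribution at
`ξ` with coefficient polynomial `p`. -/
structure Rep (F : Dist) (ξ : ℝ) (fm fp : ℝ → ℂ) (p : ℂ[X]) : Prop where
  smooth_left : ContDiff ℝ ∞ fm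
  smooth_right : ContDiff ℝ ∞ fp
  cev_eq : ∀ s ∈ testSub Set.univ, cev F s = (∫ x, s x * pw ξ fm fp x) + deltaPair ξ s p

open Polynomial in
/-- The coefficient polynomials of the point parts of the derivatives of a distribution. -/
def derivDelta (ξ : ℝ) (fm fp : ℝ → ℂ) (p : ℂ[X]) : ℕ → ℂ[X]
  | 0 => p
  | k + 1 => X * derivDelta ξ fm fp p k + C (iteratedDeriv k fp ξ - iteratedDeriv k fm ξ)

/-! ### Derivatives and star products of normal forms -/

section Rep

open Polynomial

variable {p q : ℂ[X]}

theorem Rep.lineDeriv (hF : Rep F ξ fm fp p) :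
    Rep (∂_{(1 : ℝ)} F) ξ (deriv fm) (deriv fp) (X * p + C (fp ξ - fm ξ)) where
  smooth_left := contDiff_deriv hF.smooth_left
  smooth_right := contDiff_deriv hF.smooth_right
  cev_eq s hs := by
    rw [cev_lineDeriv _ hs, hF.cev_eq _ (deriv_mem_testSub hs),
      integral_deriv_mul_pw hF.smooth_left hF.smooth_right hs, map_add, deltaPair_X_mul,
      deltaPair_C]
    ring

theorem Rep.D (hF : Rep F ξ fm fp p) (k : ℕ) :
    Rep (D k F) ξ (iteratedDeriv k fm) (iteratedDeriv k fp) (derivDelta ξ fm fp p k) := by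
  induction k with
  | zero => simpa [D_zero, derivDelta] using hF
  | succ k ih =>
    rw [D_succ, iteratedDeriv_succ, iteratedDeriv_succ]
    exact ih.lineDeriv

theorem rep_regular_pw (hm : ContDiff ℝ ∞ fm) (hp : ContDiff ℝ ∞ fp) :
    Rep (regular (pw ξ fm fp)) ξ fm fp 0 where
  smooth_left := hm
  smooth_right := hp
  cev_eq s hs := by
    rw [cev_regular (locallyIntegrable_pw hm.continuous hp.continuous) hs]; simp

theorem rep_singularCoeff {n : ℕ} (hm : ContDiff ℝ ∞ fm) (hp : ContDiff ℝ ∞ fp) (c : Fin n → ℂ) :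
    Rep (singularCoeff ξ fm fp c) ξ fm fp (∑ j : Fin n, monomial (j : ℕ) (c j)) where
  smooth_left := hm
  smooth_right := hp
  cev_eq s hs := by
    have := (rep_regular_pw (ξ := ξ) hm hp).cev_eq s hs
    rw [map_zero, add_zero] at this
    rw [singularCoeff, cev_add_dist _ _ hs]
    congr 1
    rw [cev_sum_dist _ _ hs, map_sum]
    refine Finset.sum_congr rfl fun j _ => ?_
    rw [cev_smul_dist _ _ hs, cev_D _ _ hs, cev_dirac _ (iteratedDeriv_mem_testSub hs _),
      deltaPair_monomial]
    ring

theorem Rep.eqFunOn_left (hF : Rep F ξ fm fp p) : EqFunOn F fm (Set.Iio ξ) := by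
  refine eqFunOn_of_cev fun s hs => ?_
  rw [hF.cev_eq s (testSub_univ hs), deltaPair_eq_zero (fun h => lt_irrefl ξ (hs.2.2 h)), add_zero]
  congr 1; ext x
  by_cases hx : x ∈ tsupport s
  · rw [pw_left (hs.2.2 hx)]
  · rw [image_eq_zero_of_notMem_tsupport hx]; simp

theorem Rep.eqFunOn_right (hF : Rep F ξ fm fp p) : EqFunOn F fp (Set.Ioi ξ) := by
  refine eqFunOn_of_cev fun s hs => ?_
  rw [hF.cev_eq s (testSub_univ hs), deltaPair_eq_zero (fun h => lt_irrefl ξ (hs.2.2 h)), add_zero]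
  congr 1; ext x
  by_cases hx : x ∈ tsupport s
  · rw [pw_right (hs.2.2 hx)]
  · rw [image_eq_zero_of_notMem_tsupport hx]; simp

/-- For `ε > 0` the half-lines `(-∞, ξ)` and `(ξ - ε, ∞)` cover `ℝ`. On the first, `F` is its left
branch; on the second, the translate of `G` is its right branch. -/
theorem Rep.isHormanderProduct (hF : Rep F ξ fm fp p) (hG : Rep G ξ gm gp q) {ε : ℝ} (hε : 0 < ε)
    (hQ : ∀ s ∈ testSub Set.univ, cev Q s = (∫ x, s x * (pw ξ fm fp x * pw ξ gm gp (x + ε))) +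
      deltaPair ξ ((fun x => gp (x + ε)) * s) p + deltaPair (ξ - ε) (fm * s) q) :
    IsHormanderProduct F (translate ε G) Q := by
  have hgp : ContDiff ℝ ∞ fun x => gp (x + ε) :=
    hG.smooth_right.comp (contDiff_id.add contDiff_const)
  refine ⟨2, ![Set.Iio ξ, Set.Ioi (ξ - ε)], ?_, ?_, ?_⟩
  · intro i; fin_cases i
    · exact isOpen_Iio
    · exact isOpen_Ioi
  · refine Set.eq_univ_of_forall fun x => Set.mem_iUnion.2 ?_
    rcases lt_or_ge x ξ with hx | hx
    · exact ⟨0, hx⟩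
    · exact ⟨1, show ξ - ε < x by linarith⟩
  · intro i; fin_cases i
    · refine ⟨fm, hF.smooth_left.contDiffOn, Or.inl ⟨hF.eqFunOn_left, ?_⟩⟩
      refine eqDualProductOn_of_cev fun s hs => ?_
      change s ∈ testSub (Set.Iio ξ) at hs
      have hm := testSub_univ (mul_mem_testSub hF.smooth_left hs)
      rw [hQ s (testSub_univ hs), cev_translate _ _ hm,
        hG.cev_eq _ (testSub_univ (shift_mem_testSub hm ε)), deltaPair_shift,
        deltaPair_eq_zero (s := _ * s)
          (fun h => lt_irrefl ξ (hs.2.2 (tsupport_mul_subset_right h))),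
        ← integral_sub_right_eq_self (fun x => s x * (pw ξ fm fp x * pw ξ gm gp (x + ε))) ε, add_zero]
      congr 2; ext x
      by_cases hx : x - ε ∈ tsupport s
      · rw [pw_left (hs.2.2 hx)]; simp only [Pi.mul_apply, sub_add_cancel]; ring
      · simp [image_eq_zero_of_notMem_tsupport hx]
    · refine ⟨fun x => gp (x + ε), hgp.contDiffOn, Or.inr ⟨?_, ?_⟩⟩
      · have := eqFunOn_translate isOpen_Ioi hG.smooth_right.continuous.continuousOn
          hG.eqFunOn_right ε
        convert this using 1
        ext x; simp [sub_lt_iff_lt_add]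
      refine eqDualProductOn_of_cev fun s hs => ?_
      change s ∈ testSub (Set.Ioi (ξ - ε)) at hs
      have hm := testSub_univ (mul_mem_testSub hgp hs)
      rw [hQ s (testSub_univ hs), hF.cev_eq _ hm, deltaPair_eq_zero (s := fm * s)
          (fun h => lt_irrefl (ξ - ε) (hs.2.2 (tsupport_mul_subset_right h))), add_zero]
      congr 2; ext x
      by_cases hx : x ∈ tsupport s
      · have h1 : ξ < x + ε := sub_lt_iff_lt_add.1 (hs.2.2 hx)
        rw [pw_right h1]; simp only [Pi.mul_apply]; ring
      · simp [image_eq_zero_of_notMem_tsupport hx]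

theorem continuousAt_pw (hm : Continuous fm) (hp : Continuous fp) {x : ℝ} (hx : x ≠ ξ) :
    ContinuousAt (pw ξ fm fp) x := by
  rcases lt_or_gt_of_ne hx with hx | hx
  · exact hm.continuousAt.congr (by
      filter_upwards [Iio_mem_nhds hx] with y hy using (pw_left hy).symm)
  · exact hp.continuousAt.congr (by
      filter_upwards [Ioi_mem_nhds hx] with y hy using (pw_right hy).symm)

/-- The integrands converge at every `x ≠ ξ`, since `pw` is continuous there, and are bounded
uniformly on the support of `s`. -/
theorem tendsto_integral_pw_mul_shift (hfm : Continuous fm) (hfp : Continuous fp)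
    (hgm : Continuous gm) (hgp : Continuous gp) (hs : s ∈ testSub Set.univ) :
    Tendsto (fun ε => ∫ x, s x * (pw ξ fm fp x * pw ξ gm gp (x + ε))) (𝓝[>] (0 : ℝ))
      (𝓝 (∫ x, s x * pw ξ (fm * gm) (fp * gp) x)) := by
  have hcont : Continuous fun z : ℝ × ℝ =>
      ‖s z.2‖ * ((‖fm z.2‖ + ‖fp z.2‖) * (‖gm (z.2 + z.1)‖ + ‖gp (z.2 + z.1)‖)) := by
    have := hs.1.continuous
    fun_prop
  obtain ⟨C, hC⟩ := ((isCompact_Icc (a := (0 : ℝ)) (b := 1)).prod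
    (show IsCompact (tsupport s) from hs.2.1)).exists_bound_of_continuousOn hcont.continuousOn
  have hnear : Set.Ioc (0 : ℝ) 1 ∈ 𝓝[>] (0 : ℝ) := Ioc_mem_nhdsGT one_pos
  refine tendsto_integral_filter_of_dominated_convergence
    ((tsupport s).indicator fun _ => C) ?_ ?_ ?_ ?_
  · exact Eventually.of_forall fun ε => (testSub_integrable_mul hs
      (locallyIntegrable_pw_mul_shift hfm hfp hgm hgp ε)).aestronglyMeasurable
  · filter_upwards [hnear] with ε hε
    refine Eventually.of_forall fun x => ?_
    by_cases hx : x ∈ tsupport s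
    · rw [Set.indicator_of_mem hx, norm_mul, norm_mul]
      refine le_trans ?_ ((le_abs_self _).trans (hC (ε, x) ⟨⟨hε.1.le, hε.2⟩, hx⟩))
      exact mul_le_mul_of_nonneg_left (mul_le_mul (norm_pw_le x) (norm_pw_le _) (norm_nonneg _)
        (by positivity)) (norm_nonneg _)
    · rw [image_eq_zero_of_notMem_tsupport hx, Set.indicator_of_notMem hx]; simp
  · rw [integrable_indicator_iff (isClosed_tsupport s).measurableSet]
    exact integrableOn_const (IsCompact.measure_lt_top hs.2.1).ne
  · have : ∀ᵐ x : ℝ, x ≠ ξ := by simp [ae_iff]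
    filter_upwards [this] with x hx
    rw [← pw_mul_pw]
    have h1 : Tendsto (fun ε : ℝ => x + ε) (𝓝[>] 0) (𝓝 x) := by
      have : Continuous fun ε : ℝ => x + ε := by fun_prop
      simpa using (this.tendsto 0).mono_left nhdsWithin_le_nhds
    exact (((continuousAt_pw hgm hgp hx).tendsto.comp h1).const_mul _).const_mul _

/-- The star product of two distributions with the same singular point. -/
theorem Rep.exists_isStarProduct (hF : Rep F ξ fm fp p) (hG : Rep G ξ gm gp q) :
    ∃ P, IsStarProduct F G P ∧ ∀ s ∈ testSub Set.univ,
      cev P s = (∫ x, s x * pw ξ (fm * gm) (fp * gp) x) +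
        deltaPair ξ (gp * s) p + deltaPair ξ (fm * s) q := by
  have hfm := hF.smooth_left
  have hfp := hF.smooth_right
  have hgm := hG.smooth_left
  have hgp := hG.smooth_right
  have hQ : ∀ ε : ℝ, ∃ Q : Dist, ∀ s ∈ testSub Set.univ,
      cev Q s = (∫ x, s x * (pw ξ fm fp x * pw ξ gm gp (x + ε))) +
        deltaPair ξ ((fun x => gp (x + ε)) * s) p + deltaPair (ξ - ε) (fm * s) q := by
    intro ε
    obtain ⟨T1, h1⟩ := exists_dist_deltaPair ξ (hgp.comp (contDiff_id.add contDiff_const) :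
      ContDiff ℝ ∞ fun x => gp (x + ε)) p
    obtain ⟨T2, h2⟩ := exists_dist_deltaPair (ξ - ε) hfm q
    refine ⟨regular (fun x => pw ξ fm fp x * pw ξ gm gp (x + ε)) + T1 + T2, fun s hs => ?_⟩
    rw [cev_add_dist _ _ hs, cev_add_dist _ _ hs, h1 s hs, h2 s hs, cev_regular
      (locallyIntegrable_pw_mul_shift hfm.continuous hfp.continuous hgm.continuous
        hgp.continuous ε) hs]
    rfl
  choose Q hQ using hQ
  obtain ⟨T1, h1⟩ := exists_dist_deltaPair ξ hgp p
  obtain ⟨T2, h2⟩ := exists_dist_deltaPair ξ hfm q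
  have hP : ∀ s ∈ testSub Set.univ,
      cev (regular (pw ξ (fm * gm) (fp * gp)) + T1 + T2) s =
        (∫ x, s x * pw ξ (fm * gm) (fp * gp) x) +
        deltaPair ξ (gp * s) p + deltaPair ξ (fm * s) q := fun s hs => by
    rw [cev_add_dist _ _ hs, cev_add_dist _ _ hs, h1 s hs, h2 s hs, cev_regular
      (locallyIntegrable_pw (hfm.continuous.mul hgm.continuous :
        Continuous (fm * gm)) (hfp.continuous.mul hgp.continuous : Continuous (fp * gp))) hs]
  refine ⟨_, ⟨Q, ?_, fun t => ?_⟩, hP⟩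
  · filter_upwards [self_mem_nhdsWithin] with ε hε
    exact hF.isHormanderProduct hG hε (hQ ε)
  have hs := t.mem_testSub (Set.subset_univ _)
  simp only [← cev_real _ t]
  rw [hP _ hs]
  simp only [hQ _ _ hs]
  refine ((tendsto_integral_pw_mul_shift hfm.continuous hfp.continuous hgm.continuous
    hgp.continuous hs).add ?_).add ?_
  -- The point part of `F` stays at `ξ` and its smooth factor moves with `ε`.
  · have hS : ContDiff ℝ ∞ fun z : ℝ × ℝ => gp (z.2 + z.1) * (t z.2 : ℂ) :=
      (hgp.comp (contDiff_snd.add contDiff_fst)).mul (hs.1.comp contDiff_snd)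
    have h3 := (continuous_deltaPair hS p).comp
      (continuous_id.prodMk continuous_const : Continuous fun ε : ℝ => (ε, ξ))
    have h4 := (h3.tendsto 0).mono_left (nhdsWithin_le_nhds (s := Set.Ioi 0))
    simp only [Function.comp_def, id_eq, add_zero] at h4
    exact h4
  -- The point part of `G` sits at `ξ - ε`: now the base point moves and the function is fixed.
  · have hS : ContDiff ℝ ∞ fun z : ℝ × ℝ => (fm * fun x => (t x : ℂ)) z.2 :=
      (hfm.mul hs.1).comp contDiff_snd
    have h3 := (continuous_deltaPair hS q).comp
      (continuous_const.prodMk (continuous_const.sub continuous_id) :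
        Continuous fun ε : ℝ => ((0 : ℝ), ξ - ε))
    have h4 := (h3.tendsto 0).mono_left (nhdsWithin_le_nhds (s := Set.Ioi 0))
    simp only [Function.comp_def, sub_zero] at h4
    exact h4

end Rep

end

section

/-! ### Linear systems of ordinary differential equations -/

section LinearODE

variable {E : Type*} [NormedAddCommGroup E] [NormedSpace ℝ E]

/-- The terms of the Picard series of `y' = A y`, `y x₀ = y₀`. -/
def picardTerm (A : ℝ → E →L[ℝ] E) (x₀ : ℝ) (y₀ : E) : ℕ → ℝ → E
  | 0 => fun _ => y₀
  | n + 1 => fun x => ∫ t in x₀..x, A t (picardTerm A x₀ y₀ n t)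

variable {A : ℝ → E →L[ℝ] E} {x₀ : ℝ} {y₀ : E}

theorem continuous_picardTerm (hA : Continuous A) (n : ℕ) :
    Continuous (picardTerm A x₀ y₀ n) := by
  induction n with
  | zero => exact continuous_const
  | succ n ih =>
    exact intervalIntegral.continuous_primitive
      (fun a b => (hA.clm_apply ih).intervalIntegrable a b) x₀

theorem hasDerivAt_picardTerm [CompleteSpace E] (hA : Continuous A) (n : ℕ) (x : ℝ) :
    HasDerivAt (picardTerm A x₀ y₀ (n + 1)) (A x (picardTerm A x₀ y₀ n x)) x := by
  have hc := hA.clm_apply (continuous_picardTerm (x₀ := x₀) (y₀ := y₀) hA n)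
  exact intervalIntegral.integral_hasDerivAt_right (hc.intervalIntegrable _ _)
    (hc.stronglyMeasurableAtFilter _ _) hc.continuousAt

/-- The factorial makes the Picard series converge on every bounded interval, with `K` depending on
the interval. Thus the solution is global although `A` need not be bounded on `ℝ`. -/
theorem norm_picardTerm_le (hA : Continuous A) {K R : ℝ} (hK0 : 0 ≤ K)
    (hK : ∀ x, |x - x₀| ≤ R → ‖A x‖ ≤ K) (n : ℕ) {x : ℝ} (hx : |x - x₀| ≤ R) :
    ‖picardTerm A x₀ y₀ n x‖ ≤ ‖y₀‖ * (K ^ n * |x - x₀| ^ n / n.factorial) := by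
  induction n generalizing x with
  | zero => simp [picardTerm]
  | succ n ih =>
    have hc := hA.clm_apply (continuous_picardTerm (x₀ := x₀) (y₀ := y₀) hA n)
    have hsub : ∀ t ∈ Set.uIoc x₀ x, |t - x₀| ≤ R := fun t ht =>
      (Set.abs_sub_left_of_mem_uIcc (Set.uIoc_subset_uIcc ht)).trans hx
    calc ‖picardTerm A x₀ y₀ (n + 1) x‖
        ≤ ∫ t in Set.uIoc x₀ x, ‖A t (picardTerm A x₀ y₀ n t)‖ :=
          intervalIntegral.norm_integral_le_integral_norm_uIoc
      _ ≤ ∫ t in Set.uIoc x₀ x, (‖y₀‖ * K ^ (n + 1) / n.factorial) * |t - x₀| ^ n := by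
          refine setIntegral_mono_on ?_ ?_ measurableSet_uIoc fun t ht => ?_
          · exact (hc.norm.integrableOn_uIcc).mono_set Set.uIoc_subset_uIcc
          · exact (Continuous.integrableOn_uIcc (by fun_prop)).mono_set Set.uIoc_subset_uIcc
          · calc ‖A t (picardTerm A x₀ y₀ n t)‖ ≤ ‖A t‖ * ‖picardTerm A x₀ y₀ n t‖ :=
                  (A t).le_opNorm _
              _ ≤ K * (‖y₀‖ * (K ^ n * |t - x₀| ^ n / n.factorial)) :=
                  mul_le_mul (hK t (hsub t ht)) (ih (hsub t ht)) (norm_nonneg _) hK0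
              _ = _ := by ring
      _ = ‖y₀‖ * (K ^ (n + 1) * |x - x₀| ^ (n + 1) / (n + 1).factorial) := by
          rw [integral_const_mul, integral_pow_abs_sub_uIoc, Nat.factorial_succ]
          push_cast
          field_simp

theorem exists_linearODE [CompleteSpace E] (hA : Continuous A) (x₀ : ℝ) (y₀ : E) :
    ∃ y : ℝ → E, y x₀ = y₀ ∧ ∀ x, HasDerivAt y (A x (y x)) x := by
  have hbound : ∀ R : ℝ, ∃ K : ℝ, 0 ≤ K ∧ ∀ x, |x - x₀| ≤ R → ‖A x‖ ≤ K := by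
    intro R
    obtain ⟨K, hK⟩ := (isCompact_closedBall x₀ R).exists_bound_of_continuousOn hA.continuousOn
    exact ⟨max K 0, le_max_right _ _, fun x hx => (hK x (by
      rwa [Metric.mem_closedBall, Real.dist_eq])).trans (le_max_left _ _)⟩
  have hzero : ∀ n, picardTerm A x₀ y₀ (n + 1) x₀ = 0 := fun n => by simp [picardTerm]
  have hsum : ∀ K R : ℝ, Summable fun n : ℕ => ‖y₀‖ * (K ^ n * R ^ n / n.factorial) := by
    intro K R
    simp only [← mul_pow]
    exact (Real.summable_pow_div_factorial (K * R)).mul_left _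
  have hterm : ∀ x, Summable fun n => picardTerm A x₀ y₀ n x := by
    intro x
    obtain ⟨K, hK0, hK⟩ := hbound |x - x₀|
    exact Summable.of_norm_bounded (hsum K |x - x₀|) fun n =>
      norm_picardTerm_le hA hK0 hK n le_rfl
  -- The term of index `0` is split off because the derivative of term `n + 1` is `A` applied to
  -- term `n`; termwise differentiation then gives back the full series under `A`.
  refine ⟨fun x => y₀ + ∑' n, picardTerm A x₀ y₀ (n + 1) x, by simp [hzero], fun x => ?_⟩
  obtain ⟨K, hK0, hK⟩ := hbound (|x - x₀| + 1)
  have h1 : HasDerivAt (fun z => ∑' n, picardTerm A x₀ y₀ (n + 1) z)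
      (∑' n, A x (picardTerm A x₀ y₀ n x)) x := by
    refine hasDerivAt_tsum_of_isPreconnected (t := Metric.ball x₀ (|x - x₀| + 1))
      (u := fun n => K * (‖y₀‖ * (K ^ n * (|x - x₀| + 1) ^ n / n.factorial)))
      (g' := fun n z => A z (picardTerm A x₀ y₀ n z)) (y₀ := x₀)
      ((hsum _ _).mul_left K) Metric.isOpen_ball (convex_ball _ _).isPreconnected
      (fun n z _ => hasDerivAt_picardTerm hA n z) (fun n z hz => ?_)
      (Metric.mem_ball_self (by positivity)) (by simp [hzero, summable_zero]) ?_
    · have hz' : |z - x₀| ≤ |x - x₀| + 1 := by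
        rw [Metric.mem_ball, Real.dist_eq] at hz; exact hz.le
      calc _ ≤ ‖A z‖ * ‖picardTerm A x₀ y₀ n z‖ := (A z).le_opNorm _
        _ ≤ K * (‖y₀‖ * (K ^ n * |z - x₀| ^ n / n.factorial)) :=
          mul_le_mul (hK z hz') (norm_picardTerm_le hA hK0 hK n hz') (norm_nonneg _) hK0
        _ ≤ _ := by gcongr
    · rw [Metric.mem_ball, Real.dist_eq]; linarith
  have h2 : A x (y₀ + ∑' n, picardTerm A x₀ y₀ (n + 1) x) =
      ∑' n, A x (picardTerm A x₀ y₀ n x) := by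
    rw [← (A x).map_tsum (hterm x), (hterm x).tsum_eq_zero_add]; rfl
  simpa only [h2] using h1.const_add y₀

end LinearODE

/-! ### Classical and weak solutions of smooth linear systems -/

section LinearSystem

variable {n : ℕ} {M : Fin n → Fin n → ℝ → ℂ}

/-- `v` is a smooth solution of the linear system `v' = M v`. -/
structure IsSystemSol (M : Fin n → Fin n → ℝ → ℂ) (v : Fin n → ℝ → ℂ) : Prop where
  smooth : ∀ i, ContDiff ℝ ∞ (v i)
  deriv_eq : ∀ i, deriv (v i) = ∑ k, M i k * v k

theorem exists_isSystemSol (hM : ∀ i k, ContDiff ℝ ∞ (M i k)) (x₀ : ℝ) (y₀ : Fin n → ℂ) :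
    ∃ v, IsSystemSol M v ∧ ∀ i, v i x₀ = y₀ i := by
  let A : ℝ → (Fin n → ℂ) →L[ℝ] (Fin n → ℂ) := fun x => LinearMap.toContinuousLinearMap
    ((Matrix.mulVecLin (Matrix.of fun i k => M i k x)).restrictScalars ℝ)
  have hAx : ∀ x v i, A x v i = ∑ k, M i k x * v k := fun x v i => rfl
  have hA : Continuous A := by
    rw [continuous_clm_apply]
    intro v
    refine continuous_pi fun i => ?_
    simp only [hAx]
    exact continuous_finsetSum _ fun k _ => (hM i k).continuous.mul continuous_const
  obtain ⟨y, hy0, hy⟩ := exists_linearODE hA x₀ y₀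
  have hd : ∀ i x, HasDerivAt (fun x => y x i) (∑ k, M i k x * y x k) x := fun i x =>
    hasDerivAt_pi.1 (hy x) i
  have hde : ∀ i, deriv (fun x => y x i) = ∑ k, M i k * fun x => y x k := fun i => by
    ext x; rw [(hd i x).deriv]; simp
  refine ⟨fun i x => y x i, ⟨fun i => contDiff_infty.2 fun m => ?_, hde⟩, fun i => congrFun hy0 i⟩
  -- Bootstrapping: if all components are `C^m`, so is `M y = y'`, hence they are `C^{m+1}`.
  induction m generalizing i with
  | zero => exact contDiff_zero.2 (Differentiable.continuous (𝕜 := ℝ) fun x => (hd i x).differentiableAt)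
  | succ m ih =>
    push_cast
    rw [contDiff_succ_iff_deriv]
    refine ⟨fun x => (hd i x).differentiableAt, by simp, ?_⟩
    rw [hde]
    have : ContDiff ℝ m fun x => ∑ k, M i k x * y x k :=
      ContDiff.sum fun k _ => ((hM i k).of_le (by exact_mod_cast le_top)).mul (ih k)
    have he : (∑ k, M i k * fun x => y x k) = fun x => ∑ k, M i k x * y x k := by ext x; simp
    rw [he]
    exact this

/-- `z` solves the adjoint system `z' = -Mᵀ z`, so the two contributions to the derivative of the
pairing cancel. -/
theorem IsSystemSol.pairing_eq {z v : Fin n → ℝ → ℂ} (hz : IsSystemSol (fun i k => - M k i) z)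
    (hv : IsSystemSol M v) (x x₀ : ℝ) : ∑ k, z k x * v k x = ∑ k, z k x₀ * v k x₀ := by
  have hd : ∀ x, HasDerivAt (fun x => ∑ k, z k x * v k x) 0 x := by
    intro x
    have h1 : HasDerivAt (fun x => ∑ k, z k x * v k x)
        (∑ k, (deriv (z k) x * v k x + z k x * deriv (v k) x)) x :=
      HasDerivAt.fun_sum fun k _ => (hasDerivAt_of_contDiff (hz.smooth k) x).mul
        (hasDerivAt_of_contDiff (hv.smooth k) x)
    convert h1 using 1
    simp only [hz.deriv_eq, hv.deriv_eq, Finset.sum_apply, Pi.mul_apply, Pi.neg_apply,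
      Finset.sum_add_distrib, Finset.sum_mul, Finset.mul_sum]
    rw [Finset.sum_comm (f := fun k l => z k x * (M k l x * v l x)),
      ← Finset.sum_add_distrib, eq_comm]
    refine Finset.sum_eq_zero fun k _ => ?_
    rw [← Finset.sum_add_distrib]
    exact Finset.sum_eq_zero fun l _ => by ring
  exact is_const_of_deriv_eq_zero (fun x => (hd x).differentiableAt) (fun x => (hd x).deriv) x x₀

/-- A smooth fundamental matrix `Y` together with its inverse `Z`. -/
theorem exists_fundamental (hM : ∀ i k, ContDiff ℝ ∞ (M i k)) :
    ∃ Y Z : Fin n → Fin n → ℝ → ℂ, (∀ j, IsSystemSol M fun i => Y i j) ∧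
      (∀ j, IsSystemSol (fun i k => - M k i) (Z j)) ∧
      (∀ i k, ∑ j, Y i j * Z j k = if i = k then 1 else 0) := by
  choose Y hY hY0 using fun j : Fin n => exists_isSystemSol hM 0 (Pi.single j 1)
  choose Z hZ hZ0 using fun j : Fin n => exists_isSystemSol (M := fun i k => - M k i)
    (fun i k => (hM k i).neg) 0 (Pi.single j 1)
  refine ⟨fun i j => Y j i, Z, hY, hZ, ?_⟩
  have hconst : ∀ i j x, ∑ k, Z i k x * Y j k x = (1 : Matrix (Fin n) (Fin n) ℂ) i j := by
    intro i j x
    rw [(hZ i).pairing_eq (hY j) x 0]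
    simp [hZ0, hY0, Pi.single_apply, Matrix.one_apply, eq_comm]
  intro i k
  ext x
  have h1 : (Matrix.of fun i k => Z i k x) * (Matrix.of fun k j => Y j k x) = 1 := by
    ext i j
    rw [Matrix.mul_apply]
    exact hconst i j x
  -- Constancy of the pairings gives `Z Y = 1`; for square matrices this yields `Y Z = 1`.
  have h2 := congrArg (fun N : Matrix (Fin n) (Fin n) ℂ => N i k) (mul_eq_one_comm.1 h1)
  rw [Matrix.mul_apply, Matrix.one_apply] at h2
  simp only [Matrix.of_apply] at h2
  simp only [Finset.sum_apply, Pi.mul_apply, h2]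
  split_ifs <;> rfl

theorem LinOn.sum {U : Set ℝ} {T : (ℝ → ℂ) → ℂ} (hT : LinOn U T) {ι : Type*} (I : Finset ι)
    {s : ι → ℝ → ℂ} (hs : ∀ i ∈ I, s i ∈ testSub U) : T (∑ i ∈ I, s i) = ∑ i ∈ I, T (s i) := by
  classical
  induction I using Finset.induction_on with
  | empty =>
    have := hT.smul 0 0 (zero_mem _)
    simpa using this
  | insert a I ha ih =>
    rw [Finset.sum_insert ha, Finset.sum_insert ha, hT.add _ (hs a (Finset.mem_insert_self _ _)) _
      (sum_mem fun i hi => hs i (Finset.mem_insert_of_mem hi)),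
      ih fun i hi => hs i (Finset.mem_insert_of_mem hi)]

/-- Weak solutions of a linear system with smooth coefficients are classical solutions. -/
theorem exists_isSystemSol_of_weak {U : Set ℝ} (hU : U.OrdConnected) (hUo : IsOpen U)
    (hne : U.Nonempty) (hM : ∀ i k, ContDiff ℝ ∞ (M i k)) {V : Fin n → (ℝ → ℂ) → ℂ}
    (hV : ∀ i, LinOn U (V i))
    (h : ∀ i, ∀ t ∈ testSub U, V i (deriv t) = - ∑ k, V k (M i k * t)) :
    ∃ v, IsSystemSol M v ∧ ∀ i, ∀ s ∈ testSub U, V i s = ∫ x, s x * v i x := by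
  obtain ⟨Y, Z, hY, hZ, hYZ⟩ := exists_fundamental hM
  have hZs : ∀ j i, ContDiff ℝ ∞ (Z j i) := fun j => (hZ j).smooth
  have hYs : ∀ i j, ContDiff ℝ ∞ (Y i j) := fun i j => (hY j).smooth i
  -- Variation of constants in weak form: these functionals are the components of `Z V`. They kill
  -- derivatives, hence are constants `κ j`, and `V = Y κ`.
  have hW : ∀ j, LinOn U fun t => ∑ i, V i (Z j i * t) := fun j =>
    { add := fun s hs t ht => by
        rw [← Finset.sum_add_distrib]
        refine Finset.sum_congr rfl fun i _ => ?_
        rw [mul_add, (hV i).add _ (mul_mem_testSub (hZs j i) hs) _ (mul_mem_testSub (hZs j i) ht)]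
      smul := fun c s hs => by
        rw [Finset.mul_sum]
        refine Finset.sum_congr rfl fun i _ => ?_
        rw [mul_smul_comm, (hV i).smul _ _ (mul_mem_testSub (hZs j i) hs)] }
  have hWd : ∀ j, ∀ t ∈ testSub U, ∑ i, V i (Z j i * deriv t) = 0 := by
    intro j t ht
    have h1 : ∀ i, V i (Z j i * deriv t) =
        - ∑ k, V k (M i k * (Z j i * t)) + ∑ k, V i (M k i * (Z j k * t)) := by
      intro i
      have hm := mul_mem_testSub (hZs j i) ht
      have e1 : Z j i * deriv t = deriv (Z j i * t) + ∑ k, M k i * (Z j k * t) := by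
        rw [deriv_mul_eq (hZs j i) ht.1, (hZ j).deriv_eq]
        have : ∑ k, M k i * (Z j k * t) = - ((∑ k, - M k i * Z j k) * t) := by
          rw [Finset.sum_mul, ← Finset.sum_neg_distrib]
          exact Finset.sum_congr rfl fun k _ => by ring
        rw [this]; ring
      have hmk : ∀ k ∈ Finset.univ, M k i * (Z j k * t) ∈ testSub U := fun k _ =>
        mul_mem_testSub (hM k i) (mul_mem_testSub (hZs j k) ht)
      rw [e1, (hV i).add _ (deriv_mem_testSub hm) _ (sum_mem hmk), h i _ hm, (hV i).sum _ hmk]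
    rw [Finset.sum_congr rfl fun i _ => h1 i, Finset.sum_add_distrib, Finset.sum_neg_distrib,
      Finset.sum_comm]
    exact neg_add_cancel _
  choose κ hκ using fun j => (hW j).eq_integral_of_deriv hU hUo hne (hWd j)
  have hint : ∀ i j, ∀ s ∈ testSub U, Integrable fun x => s x * (κ j * Y i j x) := fun i j s hs =>
    testSub_integrable_mul (testSub_univ hs) (continuous_const.mul (hYs i j).continuous).locallyIntegrable
  refine ⟨fun i => ∑ j, κ j • Y i j, ⟨fun i => ?_, fun i => ?_⟩, fun i s hs => ?_⟩
  · have : ContDiff ℝ ∞ fun x => ∑ j, κ j * Y i j x :=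
      ContDiff.sum fun j _ => contDiff_const.mul (hYs i j)
    convert this using 1
    ext x; simp
  · ext x
    have h1 : HasDerivAt (fun x => ∑ j, κ j * Y i j x) (∑ j, κ j * deriv (Y i j) x) x :=
      HasDerivAt.fun_sum fun j _ => (hasDerivAt_of_contDiff (hYs i j) x).const_mul _
    have h2 : (∑ j, κ j • Y i j) = fun x => ∑ j, κ j * Y i j x := by ext x; simp
    rw [h2, h1.deriv]
    simp only [fun j => (hY j).deriv_eq i, Finset.sum_apply, Pi.mul_apply, Pi.smul_apply, smul_eq_mul,
      Finset.mul_sum]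
    rw [Finset.sum_comm]
    exact Finset.sum_congr rfl fun k _ => Finset.sum_congr rfl fun j _ => by ring
  -- Insert `Y Z = 1` to express `V i` through the components of `Z V`.
  · have h1 : V i s = ∑ j, ∑ k, V k (Z j k * (Y i j * s)) := by
      rw [Finset.sum_comm, Finset.sum_eq_single i]
      · rw [← (hV i).sum _ fun j _ => mul_mem_testSub (hZs j i) (mul_mem_testSub (hYs i j) hs)]
        congr 1
        have : ∑ j, Z j i * (Y i j * s) = (∑ j, Y i j * Z j i) * s := by
          rw [Finset.sum_mul]; exact Finset.sum_congr rfl fun j _ => by ring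
        rw [this, hYZ]; simp
      · intro k _ hk
        rw [← (hV k).sum _ fun j _ => mul_mem_testSub (hZs j k) (mul_mem_testSub (hYs i j) hs)]
        have : ∑ j, Z j k * (Y i j * s) = (∑ j, Y i j * Z j k) * s := by
          rw [Finset.sum_mul]; exact Finset.sum_congr rfl fun j _ => by ring
        rw [this, hYZ, if_neg (Ne.symm hk), zero_mul]
        simpa using (hV k).smul 0 0 (zero_mem _)
      · simp
    rw [h1, Finset.sum_congr rfl fun j _ => hκ j _ (mul_mem_testSub (hYs i j) hs)]
    simp only [Finset.sum_apply, Pi.smul_apply, smul_eq_mul, Finset.mul_sum]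
    rw [integral_finsetSum _ fun j _ => hint i j s hs]
    refine Finset.sum_congr rfl fun j _ => ?_
    rw [← integral_const_mul]
    congr 1; ext x; simp only [Pi.mul_apply]; ring

/-- The components of `Z v` are constant and vanish at `x₀`; then `v = Y (Z v) = 0`. -/
theorem IsSystemSol.eq_zero {v : Fin n → ℝ → ℂ} (hM : ∀ i k, ContDiff ℝ ∞ (M i k))
    (hv : IsSystemSol M v) {x₀ : ℝ} (h0 : ∀ i, v i x₀ = 0) (i : Fin n) : v i = 0 := by
  obtain ⟨Y, Z, hY, hZ, hYZ⟩ := exists_fundamental hM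
  have hc : ∀ j x, ∑ k, Z j k x * v k x = 0 := by
    intro j x
    rw [(hZ j).pairing_eq hv x x₀]; simp [h0]
  ext x
  have h1 : v i x = ∑ j, Y i j x * ∑ k, Z j k x * v k x := by
    simp only [Finset.mul_sum]
    rw [Finset.sum_comm]
    have h2 : ∀ k, ∑ j, Y i j x * (Z j k x * v k x) = if i = k then v k x else 0 := by
      intro k
      have h3 := congrFun (hYZ i k) x
      simp only [Finset.sum_apply, Pi.mul_apply] at h3
      simp only [← mul_assoc]
      rw [← Finset.sum_mul, h3]
      split_ifs <;> simp
    simp [h2]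
  rw [h1]; simp [hc]

end LinearSystem

end

section

variable {U V : Set ℝ} {a c f g h s t u v w fm fp : ℝ → ℂ} {F G P Q : Dist} {ξ : ℝ}

/-! ### The scalar beam equation with smooth coefficients -/

/-- `u` is a smooth solution of `(a u'')'' = c u` on `ℝ`. -/
structure IsBeamSol (a c u : ℝ → ℂ) : Prop where
  smooth : ContDiff ℝ ∞ u
  eq : deriv (deriv (a * deriv (deriv u))) = c * u

/-- The matrix of the first-order system of `(a u'')'' = c u` for `(u, u', a u'', (a u'')')`. -/
def beamMat (a c : ℝ → ℂ) : Fin 4 → Fin 4 → ℝ → ℂ :=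
  ![![0, 1, 0, 0], ![0, 0, a⁻¹, 0], ![0, 0, 0, 1], ![c, 0, 0, 0]]

theorem contDiff_beamMat (ha : ContDiff ℝ ∞ a) (ha0 : ∀ x, a x ≠ 0) (hc : ContDiff ℝ ∞ c)
    (i k : Fin 4) : ContDiff ℝ ∞ (beamMat a c i k) := by
  have h0 : ContDiff ℝ ∞ (0 : ℝ → ℂ) := contDiff_const
  have h1 : ContDiff ℝ ∞ (1 : ℝ → ℂ) := contDiff_const
  have hi : ContDiff ℝ ∞ a⁻¹ := ha.inv ha0
  fin_cases i <;> fin_cases k <;> first | exact h0 | exact h1 | exact hi | exact hc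

theorem isSystemSol_beamMat_iff {v : Fin 4 → ℝ → ℂ} :
    IsSystemSol (beamMat a c) v ↔ (∀ i, ContDiff ℝ ∞ (v i)) ∧ deriv (v 0) = v 1 ∧
      deriv (v 1) = a⁻¹ * v 2 ∧ deriv (v 2) = v 3 ∧ deriv (v 3) = c * v 0 := by
  constructor
  · intro h
    refine ⟨h.smooth, ?_, ?_, ?_, ?_⟩
    all_goals rw [h.deriv_eq, Fin.sum_univ_four]; simp [beamMat]
  · rintro ⟨h, h0, h1, h2, h3⟩
    refine ⟨h, fun i => ?_⟩
    rw [Fin.sum_univ_four]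
    fin_cases i
    · simp [beamMat, h0]
    · simp [beamMat, h1]
    · simp [beamMat, h2]
    · simp [beamMat, h3]

theorem mul_inv_mul_cancel_fun (ha0 : ∀ x, a x ≠ 0) (f : ℝ → ℂ) : a * (a⁻¹ * f) = f := by
  ext x; simp [ha0 x]

theorem inv_mul_mul_cancel_fun (ha0 : ∀ x, a x ≠ 0) (f : ℝ → ℂ) : a⁻¹ * (a * f) = f := by
  ext x; simp [ha0 x]

theorem IsSystemSol.isBeamSol (ha0 : ∀ x, a x ≠ 0) {v : Fin 4 → ℝ → ℂ}
    (hv : IsSystemSol (beamMat a c) v) : IsBeamSol a c (v 0) := by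
  obtain ⟨h, h0, h1, h2, h3⟩ := isSystemSol_beamMat_iff.1 hv
  exact ⟨h 0, by rw [h0, h1, mul_inv_mul_cancel_fun ha0, h2, h3]⟩

theorem IsBeamSol.isSystemSol (ha : ContDiff ℝ ∞ a) (ha0 : ∀ x, a x ≠ 0) (hu : IsBeamSol a c u) :
    IsSystemSol (beamMat a c)
      ![u, deriv u, a * deriv (deriv u), deriv (a * deriv (deriv u))] := by
  have h2 := ha.mul (contDiff_deriv (contDiff_deriv hu.smooth))
  refine isSystemSol_beamMat_iff.2 ⟨fun i => ?_, rfl, ?_, rfl, hu.eq⟩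
  · fin_cases i
    · exact hu.smooth
    · exact contDiff_deriv hu.smooth
    · exact h2
    · exact contDiff_deriv h2
  · exact (inv_mul_mul_cancel_fun ha0 _).symm

theorem exists_isBeamSol (ha : ContDiff ℝ ∞ a) (ha0 : ∀ x, a x ≠ 0) (hc : ContDiff ℝ ∞ c)
    (x₀ : ℝ) (l : Fin 4 → ℂ) :
    ∃ u, IsBeamSol a c u ∧ ∀ i : Fin 4, iteratedDeriv i u x₀ = l i := by
  -- The prescribed derivatives are converted to values of `u, u', a u'', (a u'')'`, using `(a u'')'
  -- = a' u'' + a u'''`.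
  obtain ⟨v, hv, hv0⟩ := exists_isSystemSol (contDiff_beamMat ha ha0 hc) x₀
    ![l 0, l 1, a x₀ * l 2, deriv a x₀ * l 2 + a x₀ * l 3]
  obtain ⟨h, h0, h1, h2, h3⟩ := isSystemSol_beamMat_iff.1 hv
  have e2 : a * deriv (deriv (v 0)) = v 2 := by rw [h0, h1, mul_inv_mul_cancel_fun ha0]
  have s2 := contDiff_deriv (contDiff_deriv (h 0))
  have e3 : deriv a * deriv (deriv (v 0)) + a * deriv (deriv (deriv (v 0))) = v 3 := by
    rw [← h2, ← e2, deriv_mul_eq ha s2]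
  have f2 : deriv (deriv (v 0)) x₀ = l 2 := by
    have := congrFun e2 x₀
    rw [Pi.mul_apply, hv0 2] at this
    exact mul_left_cancel₀ (ha0 x₀) this
  refine ⟨v 0, hv.isBeamSol ha0, fun i => ?_⟩
  fin_cases i
  · simpa using hv0 0
  · have := hv0 1
    rw [← h0] at this
    simpa [iteratedDeriv_succ] using this
  · simpa [iteratedDeriv_succ] using f2
  · have := congrFun e3 x₀
    rw [hv0 3, Pi.add_apply, Pi.mul_apply, Pi.mul_apply, f2] at this
    have h4 : a x₀ * deriv (deriv (deriv (v 0))) x₀ = a x₀ * l 3 := by simpa using this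
    simpa [iteratedDeriv_succ] using mul_left_cancel₀ (ha0 x₀) h4

theorem deriv_smul_eq (k : ℂ) (hu : ContDiff ℝ ∞ u) : deriv (k • u) = k • deriv u := by
  ext x
  exact ((hasDerivAt_of_contDiff hu x).const_smul k).deriv

theorem IsBeamSol.add_smul (ha : ContDiff ℝ ∞ a) (hu : IsBeamSol a c u) (hv : IsBeamSol a c v)
    (k : ℂ) : IsBeamSol a c (u + k • v) := by
  have s1 : ∀ {f : ℝ → ℂ}, ContDiff ℝ ∞ f → ContDiff ℝ ∞ (k • f) := fun hf =>
    contDiff_const.smul hf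
  have du := contDiff_deriv hu.smooth
  have dv := contDiff_deriv hv.smooth
  have au : ContDiff ℝ ∞ (a * deriv (deriv u)) := ha.mul (contDiff_deriv du)
  have av : ContDiff ℝ ∞ (a * deriv (deriv v)) := ha.mul (contDiff_deriv dv)
  refine ⟨hu.smooth.add (s1 hv.smooth), ?_⟩
  rw [deriv_add_eq hu.smooth (s1 hv.smooth), deriv_smul_eq k hv.smooth, deriv_add_eq du (s1 dv),
    deriv_smul_eq k dv, mul_add, mul_smul_comm, deriv_add_eq au (s1 av), deriv_smul_eq k av,
    deriv_add_eq (contDiff_deriv au) (s1 (contDiff_deriv av)),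
    deriv_smul_eq k (contDiff_deriv av), hu.eq, hv.eq, mul_add, mul_smul_comm]

theorem IsBeamSol.eq_zero (ha : ContDiff ℝ ∞ a) (ha0 : ∀ x, a x ≠ 0) (hc : ContDiff ℝ ∞ c)
    (hu : IsBeamSol a c u) {x₀ : ℝ} (h0 : ∀ i : Fin 4, iteratedDeriv i u x₀ = 0) : u = 0 := by
  have d0 : u x₀ = 0 := by simpa using h0 0
  have d1 : deriv u x₀ = 0 := by simpa [iteratedDeriv_succ] using h0 1
  have d2 : deriv (deriv u) x₀ = 0 := by simpa [iteratedDeriv_succ] using h0 2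
  have d3 : deriv (deriv (deriv u)) x₀ = 0 := by simpa [iteratedDeriv_succ] using h0 3
  refine (hu.isSystemSol ha ha0).eq_zero (contDiff_beamMat ha ha0 hc) (x₀ := x₀) (fun i => ?_) 0
  rw [deriv_mul_eq ha (contDiff_deriv (contDiff_deriv hu.smooth))]
  fin_cases i <;> simp [d0, d1, d2, d3]

theorem IsBeamSol.eq_of_data (ha : ContDiff ℝ ∞ a) (ha0 : ∀ x, a x ≠ 0) (hc : ContDiff ℝ ∞ c)
    (hu : IsBeamSol a c u) (hv : IsBeamSol a c v) {x₀ : ℝ}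
    (h0 : ∀ i : Fin 4, iteratedDeriv i u x₀ = iteratedDeriv i v x₀) : u = v := by
  have h1 := (hu.add_smul ha hv (-1)).eq_zero ha ha0 hc (x₀ := x₀) (fun i => by
    have e : u + (-1 : ℂ) • v = u - v := by ext x; simp [sub_eq_add_neg]
    rw [e, iteratedDeriv_sub (hu.smooth.contDiffAt.of_le (by exact_mod_cast le_top))
      (hv.smooth.contDiffAt.of_le (by exact_mod_cast le_top)), h0, sub_self])
  ext x
  have := congrFun h1 x
  simp only [Pi.add_apply, Pi.smul_apply, smul_eq_mul, Pi.zero_apply] at this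
  linear_combination this

theorem linOn_cev (F : Dist) (U : Set ℝ) : LinOn U (cev F) :=
  ⟨fun s _ t _ => map_add _ s t, fun c s _ => map_smul _ c s⟩

/-- Weak solutions of the beam equation are classical solutions. -/
theorem exists_isBeamSol_of_weak (hU : U.OrdConnected) (hUo : IsOpen U) (hne : U.Nonempty)
    (ha : ContDiff ℝ ∞ a) (ha0 : ∀ x, a x ≠ 0) (hc : ContDiff ℝ ∞ c)
    (h : ∀ s ∈ testSub U, cev F (deriv (deriv (a * deriv (deriv s)))) = cev F (c * s)) :
    ∃ u, IsBeamSol a c u ∧ ∀ s ∈ testSub U, cev F s = ∫ x, s x * u x := by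
  -- The weak forms of `u, u', a u'', (a u'')'`, with all derivatives moved onto the test function.
  let V : Fin 4 → (ℝ → ℂ) → ℂ := ![fun s => cev F s, fun s => - cev F (deriv s),
    fun s => cev F (deriv (deriv (a * s))), fun s => - cev F (deriv (deriv (a * deriv s)))]
  have dadd : ∀ {s t : ℝ → ℂ}, s ∈ testSub U → t ∈ testSub U → deriv (s + t) = deriv s + deriv t :=
    fun hs ht => deriv_add_eq hs.1 ht.1
  have dsm : ∀ {s : ℝ → ℂ} (k : ℂ), s ∈ testSub U → deriv (k • s) = k • deriv s :=
    fun k hs => deriv_smul_eq k hs.1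
  have am : ∀ {s : ℝ → ℂ}, s ∈ testSub U → a * s ∈ testSub U := fun hs => mul_mem_testSub ha hs
  have dm : ∀ {s : ℝ → ℂ}, s ∈ testSub U → deriv s ∈ testSub U := fun hs => deriv_mem_testSub hs
  have hV : ∀ i, LinOn U (V i) := by
    intro i
    fin_cases i
    · exact linOn_cev F U
    · exact ⟨fun s hs t ht => by
        change - cev F _ = - cev F _ + - cev F _
        rw [dadd hs ht, map_add]; ring, fun k s hs => by
        change - cev F _ = k * - cev F _
        rw [dsm k hs, map_smul, smul_eq_mul]; ring⟩
    · exact ⟨fun s hs t ht => by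
        change cev F _ = cev F _ + cev F _
        rw [mul_add, dadd (am hs) (am ht), dadd (dm (am hs)) (dm (am ht)), map_add], fun k s hs => by
        change cev F _ = k * cev F _
        rw [mul_smul_comm, dsm k (am hs), dsm k (dm (am hs)), map_smul, smul_eq_mul]⟩
    · exact ⟨fun s hs t ht => by
        change - cev F _ = - cev F _ + - cev F _
        rw [dadd hs ht, mul_add, dadd (am (dm hs)) (am (dm ht)),
          dadd (dm (am (dm hs))) (dm (am (dm ht))), map_add]; ring, fun k s hs => by
        change - cev F _ = k * - cev F _
        rw [dsm k hs, mul_smul_comm, dsm k (am (dm hs)), dsm k (dm (am (dm hs))), map_smul,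
          smul_eq_mul]; ring⟩
  have hV0 : ∀ i, V i 0 = 0 := fun i => by simpa using (hV i).smul 0 0 (zero_mem _)
  obtain ⟨v, hv, hvi⟩ := exists_isSystemSol_of_weak hU hUo hne (contDiff_beamMat ha ha0 hc) hV
    (fun i t ht => by
      rw [Fin.sum_univ_four]
      fin_cases i
      · simp only [beamMat, Fin.zero_eta, Matrix.cons_val, zero_mul, one_mul, hV0]
        change cev F _ = - (0 + - cev F _ + 0 + 0)
        ring
      · simp only [beamMat, Fin.mk_one, Matrix.cons_val, zero_mul, hV0]
        change - cev F _ = - (0 + 0 + cev F _ + 0)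
        rw [mul_inv_mul_cancel_fun ha0]; ring
      · simp only [beamMat, Fin.reduceFinMk, Matrix.cons_val, zero_mul, one_mul, hV0]
        change cev F _ = - (0 + 0 + 0 + - cev F _)
        ring
      · simp only [beamMat, Fin.reduceFinMk, Matrix.cons_val, zero_mul, hV0]
        change - cev F _ = - (cev F _ + 0 + 0 + 0)
        rw [h t ht]; ring)
  exact ⟨v 0, hv.isBeamSol ha0, hvi 0⟩

/-! ### Piecewise smooth functions and normal forms -/

/-- One-sided limits at every point give integrability on a punctured one-sided neighbourhood each
time, and the point itself is a null set. -/
theorem PiecewiseSmooth.locallyIntegrable (hf : PiecewiseSmooth f) : LocallyIntegrable f := by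
  obtain ⟨S, hS, hlim⟩ := hf
  have hSo : IsOpen ((S : Set ℝ)ᶜ) := S.finite_toSet.isClosed.isOpen_compl
  have hmeas : AEStronglyMeasurable f volume := by
    have h1 := hS.continuousOn.aestronglyMeasurable (μ := volume) hSo.measurableSet
    rwa [Measure.restrict_eq_self_of_ae_mem] at h1
    exact S.finite_toSet.countable.ae_notMem volume
  intro x
  have hside : ∀ A : Set ℝ, MeasurableSet A → (∃ l, Tendsto f (𝓝[A] x) (𝓝 l)) →
      IntegrableAtFilter f (𝓝[A] x) volume := fun A hA ⟨l, hl⟩ =>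
    have := hA.nhdsWithin_isMeasurablyGenerated x
    (volume.finiteAt_nhdsWithin x A).integrableAtFilter_of_tendsto
      ⟨Set.univ, univ_mem, by simpa using hmeas⟩ hl
  have hl : ∃ l, Tendsto f (𝓝[<] x) (𝓝 l) := by
    by_cases hx : x ∈ S
    · simpa using (hlim x hx 0).1
    · exact ⟨f x, (hS.continuousOn.continuousAt (hSo.mem_nhds hx)).tendsto.mono_left
        nhdsWithin_le_nhds⟩
  have hr : ∃ l, Tendsto f (𝓝[>] x) (𝓝 l) := by
    by_cases hx : x ∈ S
    · simpa using (hlim x hx 0).2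
    · exact ⟨f x, (hS.continuousOn.continuousAt (hSo.mem_nhds hx)).tendsto.mono_left
        nhdsWithin_le_nhds⟩
  have hpure : IntegrableAtFilter f (pure x) volume := ⟨{x}, by simp, by simp⟩
  have := IntegrableAtFilter.sup_iff.2 ⟨IntegrableAtFilter.sup_iff.2
    ⟨hside _ measurableSet_Iio hl, hside _ measurableSet_Ioi hr⟩, hpure⟩
  rwa [nhdsLT_sup_nhdsGT, sup_comm, pure_sup_nhdsNE] at this

theorem mem_derivLocInt_of_mem_spaceA (hF : F ∈ spaceA) : F ∈ derivLocInt := by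
  obtain ⟨k, f, hf, rfl⟩ := hF
  exact ⟨k, f, hf.locallyIntegrable, rfl⟩

theorem D_mem_derivLocInt (hF : F ∈ derivLocInt) (m : ℕ) : D m F ∈ derivLocInt := by
  obtain ⟨k, f, hf, rfl⟩ := hF
  exact ⟨m + k, f, hf, D_D _ _ _⟩

theorem piecewiseSmooth_pw (hm : ContDiff ℝ ∞ fm) (hp : ContDiff ℝ ∞ fp) :
    PiecewiseSmooth (pw ξ fm fp) := by
  have hl : Set.EqOn (pw ξ fm fp) fm (Set.Iio ξ) := fun x hx => pw_left hx
  have hr : Set.EqOn (pw ξ fm fp) fp (Set.Ioi ξ) := fun x hx => pw_right hx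
  refine ⟨{ξ}, fun x hx => ?_, fun x hx k => ?_⟩
  · rcases lt_or_gt_of_ne (show x ≠ ξ by simpa using hx) with h | h
    · exact (hm.contDiffAt.congr_of_eventuallyEq
        (hl.eventuallyEq_of_mem (Iio_mem_nhds h))).contDiffWithinAt
    · exact (hp.contDiffAt.congr_of_eventuallyEq
        (hr.eventuallyEq_of_mem (Ioi_mem_nhds h))).contDiffWithinAt
  · obtain rfl : x = ξ := by simpa using hx
    refine ⟨⟨iteratedDeriv k fm x, ?_⟩, ⟨iteratedDeriv k fp x, ?_⟩⟩
    · refine (((contDiff_iteratedDeriv hm k).continuous.tendsto x).mono_left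
        nhdsWithin_le_nhds).congr' ?_
      filter_upwards [self_mem_nhdsWithin] with y hy
      exact (hl.iteratedDeriv_of_isOpen isOpen_Iio k hy).symm
    · refine (((contDiff_iteratedDeriv hp k).continuous.tendsto x).mono_left
        nhdsWithin_le_nhds).congr' ?_
      filter_upwards [self_mem_nhdsWithin] with y hy
      exact (hr.iteratedDeriv_of_isOpen isOpen_Ioi k hy).symm

/-- If the `k`-th derivative is smooth on an interval, so is the distribution; the primitives
obtained are smooth on all of `ℝ`, past the ends of `U`. -/
theorem exists_iterated_primitive (hU : U.OrdConnected) (hUo : IsOpen U) (hne : U.Nonempty)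
    (k : ℕ) (hu : ContDiff ℝ ∞ u) (h : ∀ s ∈ testSub U, cev (D k F) s = ∫ x, s x * u x) :
    ∃ w, ContDiff ℝ ∞ w ∧ iteratedDeriv k w = u ∧ ∀ s ∈ testSub U, cev F s = ∫ x, s x * w x := by
  induction k generalizing u with
  | zero => exact ⟨u, hu, iteratedDeriv_zero, h⟩
  | succ k ih =>
    obtain ⟨w₁, hw₁, hd, hw₁s⟩ := (linOn_cev (D k F) U).exists_antideriv hU hUo hne hu
      (fun t ht => by
        have := h t ht
        rw [D_succ, cev_lineDeriv _ (testSub_univ ht)] at this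
        linear_combination -this)
    obtain ⟨w, hw, hwk, hws⟩ := ih hw₁ hw₁s
    exact ⟨w, hw, by rw [iteratedDeriv_succ, hwk, hd], hws⟩

theorem ae_eq_on_of_cev_regular (hUo : IsOpen U) (hf : LocallyIntegrable f) (hw : Continuous w)
    (h : ∀ s ∈ testSub U, cev (regular f) s = ∫ x, s x * w x) : ∀ᵐ x : ℝ, x ∈ U → f x = w x := by
  have := hUo.ae_eq_zero_of_integral_contDiff_smul_eq_zero (μ := volume) (f := f - w)
    ((hf.sub hw.locallyIntegrable).locallyIntegrableOn U) (fun t ht hc htU => by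
      have hm := ofReal_mem_testSub ht hc htU
      have e1 := h _ hm
      rw [cev_regular hf (testSub_univ hm)] at e1
      calc ∫ x, t x • (f - w) x = ∫ x, ((t x : ℂ) * f x - (t x : ℂ) * w x) := by
            congr 1; ext x; simp [mul_sub]
        _ = 0 := by
            rw [integral_sub (testSub_integrable_mul (testSub_univ hm) hf)
              (testSub_integrable_mul (testSub_univ hm) hw.locallyIntegrable), e1, sub_self])
  filter_upwards [this] with x hx hxU
  exact sub_eq_zero.1 (hx hxU)

/-- An element of `𝒜` that is smooth on both sides of `ξ` up to `ξ` has a normal form there. -/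
theorem exists_rep (hF : F ∈ derivLocInt) (hm : ContDiff ℝ ∞ fm) (hp : ContDiff ℝ ∞ fp)
    (hl : ∀ s ∈ testSub (Set.Iio ξ), cev F s = ∫ x, s x * fm x)
    (hr : ∀ s ∈ testSub (Set.Ioi ξ), cev F s = ∫ x, s x * fp x) : ∃ p, Rep F ξ fm fp p := by
  obtain ⟨k, f, hf, rfl⟩ := hF
  -- Undoing the `k` derivatives on each side shows that `f` itself is almost everywhere `pw ξ wm
  -- wp` with smooth branches. Differentiating back `k` times creates only point terms at `ξ`.
  obtain ⟨wm, hwm, rfl, hwms⟩ := exists_iterated_primitive Set.ordConnected_Iio isOpen_Iio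
    Set.nonempty_Iio k hm hl
  obtain ⟨wp, hwp, rfl, hwps⟩ := exists_iterated_primitive Set.ordConnected_Ioi isOpen_Ioi
    Set.nonempty_Ioi k hp hr
  have h1 := ae_eq_on_of_cev_regular isOpen_Iio hf hwm.continuous hwms
  have h2 := ae_eq_on_of_cev_regular isOpen_Ioi hf hwp.continuous hwps
  have h3 : ∀ᵐ x : ℝ, x ≠ ξ := by simp [ae_iff]
  have h4 : f =ᵐ[volume] pw ξ wm wp := by
    filter_upwards [h1, h2, h3] with x h1 h2 h3
    rcases lt_or_gt_of_ne h3 with h | h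
    · rw [h1 h, pw_left h]
    · rw [h2 h, pw_right h]
  have h5 : regular f = regular (pw ξ wm wp) := dist_ext fun s hs => by
    rw [cev_regular hf hs, cev_regular (locallyIntegrable_pw hwm.continuous hwp.continuous) hs]
    refine integral_congr_ae ?_
    filter_upwards [h4] with x hx
    rw [hx]
  exact ⟨_, h5 ▸ (rep_regular_pw hwm hwp).D k⟩

end

section

open Polynomial

variable {U V : Set ℝ} {a c f g h s t u v w fm fp um up : ℝ → ℂ} {F G P Q Φ : Dist} {ξ : ℝ}
  {p q : ℂ[X]}

/-! ### Jets at the singular point -/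

theorem iteratedDeriv_iteratedDeriv (m k : ℕ) (f : ℝ → ℂ) :
    iteratedDeriv m (iteratedDeriv k f) = iteratedDeriv (m + k) f := by
  simp only [iteratedDeriv_eq_iterate, Function.iterate_add_apply]

theorem leibniz (hf : ContDiff ℝ ∞ f) (hg : ContDiff ℝ ∞ g) (n : ℕ) (x : ℝ) :
    iteratedDeriv n (f * g) x = ∑ i ∈ Finset.range (n + 1),
      (n.choose i : ℂ) * iteratedDeriv i f x * iteratedDeriv (n - i) g x :=
  iteratedDeriv_mul (hf.contDiffAt.of_le (by exact_mod_cast le_top))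
    (hg.contDiffAt.of_le (by exact_mod_cast le_top))

theorem leibniz_iterated (hf : ContDiff ℝ ∞ f) (hg : ContDiff ℝ ∞ g) (i j n : ℕ) (x : ℝ) :
    iteratedDeriv n (iteratedDeriv i f * iteratedDeriv j g) x = ∑ k ∈ Finset.range (n + 1),
      (n.choose k : ℂ) * iteratedDeriv (k + i) f x * iteratedDeriv (n - k + j) g x := by
  rw [leibniz (contDiff_iteratedDeriv hf i) (contDiff_iteratedDeriv hg j)]
  simp only [iteratedDeriv_iteratedDeriv]

theorem leibniz_left (hf : ContDiff ℝ ∞ f) (hg : ContDiff ℝ ∞ g) (i n : ℕ) (x : ℝ) :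
    iteratedDeriv n (iteratedDeriv i f * g) x = ∑ k ∈ Finset.range (n + 1),
      (n.choose k : ℂ) * iteratedDeriv (k + i) f x * iteratedDeriv (n - k) g x := by
  rw [leibniz (contDiff_iteratedDeriv hf i) hg]
  simp only [iteratedDeriv_iteratedDeriv]

/-- Differentiating `k` times turns the jump of the `m`-th derivative into a multiple of
`δ^{(k-1-m)}`. -/
theorem deltaPair_derivDelta (ξ : ℝ) (fm fp s : ℝ → ℂ) (p : ℂ[X]) (k : ℕ) :
    deltaPair ξ s (derivDelta ξ fm fp p k) = (-1) ^ k * deltaPair ξ (iteratedDeriv k s) p +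
      ∑ m ∈ Finset.range k, (-1) ^ (k - 1 - m) * (iteratedDeriv m fp ξ - iteratedDeriv m fm ξ) *
        iteratedDeriv (k - 1 - m) s ξ := by
  induction k generalizing s with
  | zero => simp [derivDelta]
  | succ k ih =>
    rw [derivDelta, map_add, deltaPair_X_mul, ih, deltaPair_C, Finset.sum_range_succ,
      ← iteratedDeriv_succ', neg_add, ← Finset.sum_neg_distrib]
    have : ∀ m ∈ Finset.range k, -((-1) ^ (k - 1 - m) *
        (iteratedDeriv m fp ξ - iteratedDeriv m fm ξ) * iteratedDeriv (k - 1 - m) (deriv s) ξ) =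
        (-1) ^ (k + 1 - 1 - m) * (iteratedDeriv m fp ξ - iteratedDeriv m fm ξ) *
        iteratedDeriv (k + 1 - 1 - m) s ξ := by
      intro m hm
      have h1 : k + 1 - 1 - m = (k - 1 - m) + 1 := by
        have := Finset.mem_range.1 hm; omega
      rw [h1, iteratedDeriv_succ', pow_succ]; ring
    rw [Finset.sum_congr rfl this]
    simp [pow_succ]
    ring

/-- Jumps contribute only in degrees below `k`; above that the coefficients of `p` are merely
shifted. -/
theorem derivDelta_coeff (ξ : ℝ) (fm fp : ℝ → ℂ) (p : ℂ[X]) (k n : ℕ) :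
    (derivDelta ξ fm fp p k).coeff (n + k) = p.coeff n := by
  induction k with
  | zero => rfl
  | succ k ih =>
    rw [derivDelta, coeff_add, ← add_assoc, coeff_X_mul, coeff_C_succ, add_zero, ih]

theorem natDegree_derivDelta_le (ξ : ℝ) (fm fp : ℝ → ℂ) (p : ℂ[X]) (k : ℕ) :
    (derivDelta ξ fm fp p k).natDegree ≤ p.natDegree + k := by
  induction k with
  | zero => rfl
  | succ k ih =>
    refine natDegree_add_le_of_degree_le ?_ ((natDegree_C _).trans_le zero_le)
    refine natDegree_mul_le.trans ?_
    have := natDegree_X_le (R := ℂ)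
    omega

theorem natDegree_sum_monomial_le {n : ℕ} (c : Fin (n + 1) → ℂ) :
    (∑ j : Fin (n + 1), monomial (j : ℕ) (c j)).natDegree ≤ n :=
  natDegree_sum_le_of_forall_le _ _ fun j _ => (natDegree_monomial_le _).trans (by omega)

/-- The monomial `(x - ξ)^M`. -/
def shiftPow (ξ : ℝ) (M : ℕ) (x : ℝ) : ℂ := ((x - ξ : ℝ) : ℂ) ^ M

theorem contDiff_shiftPow (ξ : ℝ) (M : ℕ) : ContDiff ℝ ∞ (shiftPow ξ M) :=
  (Complex.ofRealCLM.contDiff.comp (contDiff_id.sub contDiff_const)).pow M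

theorem deriv_shiftPow (ξ : ℝ) (M : ℕ) :
    deriv (shiftPow ξ (M + 1)) = ((M + 1 : ℕ) : ℂ) • shiftPow ξ M := by
  ext x
  have h1 : HasDerivAt (fun x : ℝ => ((x - ξ : ℝ) : ℂ)) ((1 : ℝ) : ℂ) x :=
    ((hasDerivAt_id x).sub_const ξ).ofReal_comp
  have h2 := h1.pow (M + 1)
  have h3 := h2.deriv
  simp only [add_tsub_cancel_right, Complex.ofReal_one, mul_one] at h3
  exact h3

/-- The factor `(x - ξ)^M` kills all derivatives at `ξ` of order below `M`. Multiplied by a cutoff,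
it serves to isolate top coefficients of point distributions. -/
theorem iteratedDeriv_shiftPow_mul (ξ : ℝ) {j M : ℕ} (hj : j ≤ M) (hg : ContDiff ℝ ∞ g) :
    iteratedDeriv j (shiftPow ξ M * g) ξ = if j = M then (M.factorial : ℂ) * g ξ else 0 := by
  induction j generalizing M g with
  | zero =>
    rcases M with _ | M
    · simp [shiftPow]
    · simp [shiftPow]
  | succ j ih =>
    obtain ⟨M, rfl⟩ : ∃ M', M = M' + 1 := ⟨M - 1, by omega⟩
    have h1 : ContDiff ℝ ∞ (((M + 1 : ℕ) : ℂ) • g + shiftPow ξ 1 * deriv g) :=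
      (contDiff_const.smul hg).add ((contDiff_shiftPow ξ 1).mul (contDiff_deriv hg))
    have h2 : deriv (shiftPow ξ (M + 1) * g) =
        shiftPow ξ M * (((M + 1 : ℕ) : ℂ) • g + shiftPow ξ 1 * deriv g) := by
      rw [deriv_mul_eq (contDiff_shiftPow _ _) hg, deriv_shiftPow]
      ext x
      simp [shiftPow, pow_succ]; ring
    rw [iteratedDeriv_succ', h2, ih (by omega) h1]
    simp only [add_left_inj]
    split_ifs
    · simp [shiftPow, Nat.factorial_succ]; ring
    · rfl

theorem deltaPair_mul_shiftPow (ξ : ℝ) {M : ℕ} (hq : q.natDegree ≤ M) (hf : ContDiff ℝ ∞ f)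
    (hg : ContDiff ℝ ∞ g) :
    deltaPair ξ (f * (shiftPow ξ M * g)) q = (-1) ^ M * (M.factorial * (f ξ * g ξ)) * q.coeff M := by
  have h1 : f * (shiftPow ξ M * g) = shiftPow ξ M * (f * g) := by ring
  have hfg : ContDiff ℝ ∞ (f * g) := hf.mul hg
  rw [h1, deltaPair_apply, Finset.sum_eq_single M]
  · rw [iteratedDeriv_shiftPow_mul ξ le_rfl hfg]; simp
  · intro j hj hjM
    have : j ≤ q.natDegree := le_natDegree_of_mem_supp j hj
    rw [iteratedDeriv_shiftPow_mul ξ (this.trans hq) hfg]; simp [hjM]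
  · intro hM; rw [notMem_support_iff.1 hM, mul_zero]

theorem exists_testSub_eq_one (ξ : ℝ) : ∃ χ ∈ testSub Set.univ, χ ξ = 1 := by
  let b : ContDiffBump ξ := ⟨1, 2, one_pos, one_lt_two⟩
  refine ⟨_, ofReal_mem_testSub b.contDiff b.hasCompactSupport (Set.subset_univ _), ?_⟩
  exact_mod_cast b.one_of_mem_closedBall (Metric.mem_closedBall_self zero_le_one)

/-- Testing with `(x - ξ)^M` times a cutoff gives a triangular system for `ρ`. -/
theorem eq_zero_of_jet {ρ : Fin 4 → ℂ} (h : ∀ s ∈ testSub Set.univ,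
    ∑ m : Fin 4, (-1) ^ (m : ℕ) * ρ m * iteratedDeriv m s ξ = 0) : ρ = 0 := by
  obtain ⟨χ, hχ, hχ1⟩ := exists_testSub_eq_one ξ
  have key : ∀ M : ℕ, ∑ m : Fin 4, (-1) ^ (m : ℕ) * ρ m *
      iteratedDeriv m (shiftPow ξ M * χ) ξ = 0 := fun M =>
    h _ (mul_mem_testSub (contDiff_shiftPow ξ M) hχ)
  have val : ∀ j M : ℕ, j ≤ M → iteratedDeriv j (shiftPow ξ M * χ) ξ =
      if j = M then (M.factorial : ℂ) else 0 := fun j M hj => by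
    rw [iteratedDeriv_shiftPow_mul ξ hj hχ.1, hχ1, mul_one]
  -- Solved downwards from `M = 3`: terms with `m < M` vanish by the choice of test function, those
  -- with `m > M` by the previous steps.
  have k3 := key 3
  have k2 := key 2
  have k1 := key 1
  have k0 := key 0
  simp only [Fin.sum_univ_four, Fin.coe_ofNat_eq_mod]
    at k0 k1 k2 k3
  norm_num [val, Nat.factorial] at k3
  norm_num [val, Nat.factorial, k3] at k2
  norm_num [val, Nat.factorial, k3, k2] at k1
  norm_num [val, Nat.factorial, k3, k2, k1] at k0
  ext m; fin_cases m
  · exact k0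
  · exact k1
  · exact k2
  · exact k3

/-! ### The interface condition -/

theorem sum_integral_pw {ι : Type*} (I : Finset ι) (k : ι → ℂ) {fm fp : ι → ℝ → ℂ}
    (hm : ∀ i, Continuous (fm i)) (hp : ∀ i, Continuous (fp i)) (hs : s ∈ testSub Set.univ) :
    ∑ i ∈ I, k i * ∫ x, s x * pw ξ (fm i) (fp i) x =
      ∫ x, s x * pw ξ (fun x => ∑ i ∈ I, k i * fm i x) (fun x => ∑ i ∈ I, k i * fp i x) x := by
  simp only [← integral_const_mul]
  rw [← integral_finsetSum _ fun i _ =>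
    (testSub_integrable_mul hs (locallyIntegrable_pw (hm i) (hp i))).const_mul _]
  congr 1; ext x
  simp only [pw, Finset.sum_mul]
  rw [← Finset.sum_add_distrib, Finset.mul_sum]
  exact Finset.sum_congr rfl fun i _ => by ring

theorem deriv_deriv_eq (f : ℝ → ℂ) : deriv (deriv f) = iteratedDeriv 2 f := by
  rw [iteratedDeriv_succ, iteratedDeriv_one]

/-- The left side is the formal adjoint of `φ ↦ f φ'''' + 2 f' φ''' + f'' φ'' = (f φ'')''`, and this
operator is formally self-adjoint. -/
theorem beam_adjoint_identity (hf : ContDiff ℝ ∞ f) (hs : ContDiff ℝ ∞ s) :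
    iteratedDeriv 4 (f * s) - (2 : ℂ) • iteratedDeriv 3 (iteratedDeriv 1 f * s) +
      iteratedDeriv 2 (iteratedDeriv 2 f * s) = deriv (deriv (f * deriv (deriv s))) := by
  rw [deriv_deriv_eq, deriv_deriv_eq]
  ext x
  have h0 := leibniz_iterated hf hs 0 0 4 x
  have h1 := leibniz_iterated hf hs 1 0 3 x
  have h2 := leibniz_iterated hf hs 2 0 2 x
  have h3 := leibniz_iterated hf hs 0 2 2 x
  simp only [iteratedDeriv_zero (f := f), iteratedDeriv_zero (f := s), Finset.sum_range_succ,
    Finset.sum_range_zero] at h0 h1 h2 h3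
  simp only [Pi.add_apply, Pi.sub_apply, Pi.smul_apply, smul_eq_mul, h0, h1, h2, h3]
  norm_num [Nat.choose]
  ring

theorem IsBeamSol.expand (ha : ContDiff ℝ ∞ a) (hu : IsBeamSol a c u) (x : ℝ) :
    a x * iteratedDeriv 4 u x + 2 * (iteratedDeriv 1 a x * iteratedDeriv 3 u x) +
      iteratedDeriv 2 a x * iteratedDeriv 2 u x = c x * u x := by
  have h1 := congrFun hu.eq x
  rw [deriv_deriv_eq, deriv_deriv_eq] at h1
  have h2 := leibniz_iterated ha hu.smooth 0 2 2 x
  rw [iteratedDeriv_zero, h1] at h2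
  simp only [Finset.sum_range_succ, Finset.sum_range_zero, Pi.mul_apply] at h2
  norm_num [Nat.choose] at h2 ⊢
  linear_combination -h2

namespace Data

variable {E : Data}

/-- The coefficient `w² (b_{0-} + b_{1-})` of the equation to the left of `ξ`. -/
def cMinus (E : Data) : ℝ → ℂ := E.w ^ 2 • (E.bm 0 + E.bm 1)

/-- The coefficient `w² (b_{0+} + b_{1+})` of the equation to the right of `ξ`. -/
def cPlus (E : Data) : ℝ → ℂ := E.w ^ 2 • (E.bp 0 + E.bp 1)

theorem contDiff_aMinus : ContDiff ℝ ∞ E.aMinus := (E.am_smooth 0).add (E.am_smooth 1)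

theorem contDiff_aPlus : ContDiff ℝ ∞ E.aPlus := (E.ap_smooth 0).add (E.ap_smooth 1)

theorem contDiff_cMinus : ContDiff ℝ ∞ E.cMinus :=
  contDiff_const.smul ((E.bm_smooth 0).add (E.bm_smooth 1))

theorem contDiff_cPlus : ContDiff ℝ ∞ E.cPlus :=
  contDiff_const.smul ((E.bp_smooth 0).add (E.bp_smooth 1))

theorem iteratedDeriv_aMinus (k : ℕ) (x : ℝ) :
    iteratedDeriv k E.aMinus x = iteratedDeriv k (E.am 0) x + iteratedDeriv k (E.am 1) x :=
  iteratedDeriv_add ((E.am_smooth 0).contDiffAt.of_le (by exact_mod_cast le_top))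
    ((E.am_smooth 1).contDiffAt.of_le (by exact_mod_cast le_top))

theorem iteratedDeriv_aPlus (k : ℕ) (x : ℝ) :
    iteratedDeriv k E.aPlus x = iteratedDeriv k (E.ap 0) x + iteratedDeriv k (E.ap 1) x :=
  iteratedDeriv_add ((E.ap_smooth 0).contDiffAt.of_le (by exact_mod_cast le_top))
    ((E.ap_smooth 1).contDiffAt.of_le (by exact_mod_cast le_top))

theorem iteratedDeriv_a (k : ℕ) (x : ℝ) :
    iteratedDeriv k E.a x = iteratedDeriv k (E.am 0) x + iteratedDeriv k (E.ap 1) x :=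
  iteratedDeriv_add ((E.am_smooth 0).contDiffAt.of_le (by exact_mod_cast le_top))
    ((E.ap_smooth 1).contDiffAt.of_le (by exact_mod_cast le_top))

/-- The coefficient polynomial of the point part of `a_i`. -/
def polyA (E : Data) (i : Fin 2) : ℂ[X] := ∑ j : Fin 2, monomial (j : ℕ) (E.A i j)

/-- The coefficient polynomial of the point part of `b_i`. -/
def polyB (E : Data) (i : Fin 2) : ℂ[X] := ∑ j : Fin 4, monomial (j : ℕ) (E.B i j)

theorem rep_coeffA (i : Fin 2) : Rep (E.coeffA i) E.ξ (E.am i) (E.ap i) (E.polyA i) :=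
  rep_singularCoeff (E.am_smooth i) (E.ap_smooth i) _

theorem rep_coeffB (i : Fin 2) : Rep (E.coeffB i) E.ξ (E.bm i) (E.bp i) (E.polyB i) :=
  rep_singularCoeff (E.bm_smooth i) (E.bp_smooth i) _

/-- The coefficient polynomial of the point part of the `k`-th derivative of `a_i`. -/
def polyDA (E : Data) (i : Fin 2) (k : ℕ) : ℂ[X] :=
  derivDelta E.ξ (E.am i) (E.ap i) (E.polyA i) k

/-- The pairing with `s` of the point part of the left-hand side of the equation. -/
def interface (E : Data) (um up : ℝ → ℂ) (p : ℂ[X]) (s : ℝ → ℂ) : ℂ :=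
  ∑ i : Fin 3, (Nat.choose 2 i : ℂ) *
    ((deltaPair E.ξ (iteratedDeriv (4 - i) up * s) (E.polyDA 0 i) +
      deltaPair E.ξ (iteratedDeriv i (E.am 0) * s) (derivDelta E.ξ um up p (4 - i))) +
    (deltaPair E.ξ (iteratedDeriv i (E.ap 1) * s) (derivDelta E.ξ um up p (4 - i)) +
      deltaPair E.ξ (iteratedDeriv (4 - i) um * s) (E.polyDA 1 i))) -
  E.w ^ 2 * ((deltaPair E.ξ (up * s) (E.polyB 0) + deltaPair E.ξ (E.bm 0 * s) p) +
    (deltaPair E.ξ (E.bp 1 * s) p + deltaPair E.ξ (um * s) (E.polyB 1)))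

theorem exists_products (hΦ : Rep Φ E.ξ um up p) (hm : IsBeamSol E.aMinus E.cMinus um)
    (hp : IsBeamSol E.aPlus E.cPlus up) :
    ∃ (P Q : Fin 3 → Dist) (R S : Dist),
      (∀ i : Fin 3, IsStarProduct (D i (E.coeffA 0)) (D (4 - i) Φ) (P i)) ∧
      (∀ i : Fin 3, IsStarProduct (D (4 - i) Φ) (D i (E.coeffA 1)) (Q i)) ∧
      IsStarProduct (E.coeffB 0) Φ R ∧ IsStarProduct Φ (E.coeffB 1) S ∧
      ∀ s ∈ testSub Set.univ,
        cev (∑ i : Fin 3, (Nat.choose 2 i : ℂ) • (P i + Q i) - E.w ^ 2 • (R + S)) s =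
          E.interface um up p s := by
  choose P hP hPs using fun i : Fin 3 => ((rep_coeffA (E := E) 0).D i).exists_isStarProduct
    (hΦ.D (4 - i))
  choose Q hQ hQs using fun i : Fin 3 => (hΦ.D (4 - i)).exists_isStarProduct
    ((rep_coeffA (E := E) 1).D i)
  obtain ⟨R, hR, hRs⟩ := (rep_coeffB (E := E) 0).exists_isStarProduct hΦ
  obtain ⟨S, hS, hSs⟩ := hΦ.exists_isStarProduct (rep_coeffB (E := E) 1)
  refine ⟨P, Q, R, S, hP, hQ, hR, hS, fun s hs => ?_⟩
  rw [cev_sub_dist _ _ hs, cev_sum_dist _ _ hs, cev_smul_dist _ _ hs, cev_add_dist _ _ hs,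
    hRs s hs, hSs s hs]
  simp only [cev_smul_dist _ _ hs, cev_add_dist _ _ hs, hPs _ s hs, hQs _ s hs]
  have hcA : ∀ i k, Continuous (iteratedDeriv k (E.am i)) := fun i k =>
    (contDiff_iteratedDeriv (E.am_smooth i) k).continuous
  have hcA' : ∀ i k, Continuous (iteratedDeriv k (E.ap i)) := fun i k =>
    (contDiff_iteratedDeriv (E.ap_smooth i) k).continuous
  have hcm : ∀ k, Continuous (iteratedDeriv k um) := fun k =>
    (contDiff_iteratedDeriv hm.smooth k).continuous
  have hcp : ∀ k, Continuous (iteratedDeriv k up) := fun k =>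
    (contDiff_iteratedDeriv hp.smooth k).continuous
  have h1 := sum_integral_pw (ξ := E.ξ) (s := s) Finset.univ
    (fun i : Fin 3 => (Nat.choose 2 i : ℂ))
    (fm := fun i => iteratedDeriv i (E.am 0) * iteratedDeriv (4 - i) um +
      iteratedDeriv (4 - i) um * iteratedDeriv i (E.am 1))
    (fp := fun i => iteratedDeriv i (E.ap 0) * iteratedDeriv (4 - i) up +
      iteratedDeriv (4 - i) up * iteratedDeriv i (E.ap 1))
    (fun i => ((hcA 0 _).mul (hcm _)).add ((hcm _).mul (hcA 1 _)))
    (fun i => ((hcA' 0 _).mul (hcp _)).add ((hcp _).mul (hcA' 1 _))) hs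
  have hadd : ∀ {fm fp gm gp : ℝ → ℂ}, Continuous fm → Continuous fp → Continuous gm →
      Continuous gp → ∫ x, s x * pw E.ξ (fm + gm) (fp + gp) x =
        (∫ x, s x * pw E.ξ fm fp x) + ∫ x, s x * pw E.ξ gm gp x := by
    intro fm fp gm gp h1 h2 h3 h4
    rw [← integral_add (testSub_integrable_mul hs (locallyIntegrable_pw h1 h2))
      (testSub_integrable_mul hs (locallyIntegrable_pw h3 h4))]
    congr 1; ext x; simp only [pw, Pi.add_apply]; ring
  simp only [hadd ((hcA 0 _).mul (hcm _)) ((hcA' 0 _).mul (hcp _)) ((hcm _).mul (hcA 1 _))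
    ((hcp _).mul (hcA' 1 _))] at h1
  have h2 := hadd ((E.bm_smooth 0).continuous.mul hm.smooth.continuous)
    ((E.bp_smooth 0).continuous.mul hp.smooth.continuous)
    (hm.smooth.continuous.mul (E.bm_smooth 1).continuous)
    (hp.smooth.continuous.mul (E.bp_smooth 1).continuous)
  -- The regular part of the left-hand side is zero: each branch satisfies its own expanded beam
  -- equation.
  have h3 : (∫ x, s x * pw E.ξ (fun x => ∑ i : Fin 3, (Nat.choose 2 i : ℂ) *
        (iteratedDeriv i (E.am 0) * iteratedDeriv (4 - i) um +
          iteratedDeriv (4 - i) um * iteratedDeriv i (E.am 1)) x)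
      (fun x => ∑ i : Fin 3, (Nat.choose 2 i : ℂ) *
        (iteratedDeriv i (E.ap 0) * iteratedDeriv (4 - i) up +
          iteratedDeriv (4 - i) up * iteratedDeriv i (E.ap 1)) x) x) =
      E.w ^ 2 * ∫ x, s x * pw E.ξ (E.bm 0 * um + um * E.bm 1) (E.bp 0 * up + up * E.bp 1) x := by
    rw [← integral_const_mul]
    congr 1; ext x
    have em := hm.expand contDiff_aMinus x
    have ep := hp.expand contDiff_aPlus x
    rw [iteratedDeriv_aMinus, iteratedDeriv_aMinus] at em
    rw [iteratedDeriv_aPlus, iteratedDeriv_aPlus] at ep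
    simp only [iteratedDeriv_one, aMinus, cMinus, Pi.smul_apply, Pi.add_apply, smul_eq_mul] at em
    simp only [iteratedDeriv_one, aPlus, cPlus, Pi.smul_apply, Pi.add_apply, smul_eq_mul] at ep
    simp only [pw, Fin.sum_univ_three, Fin.val_zero, Fin.val_one, Fin.val_two, Pi.add_apply,
      Pi.mul_apply, iteratedDeriv_zero, iteratedDeriv_one, Nat.choose, Nat.sub_zero]
    norm_num
    linear_combination (s x * heaviside (E.ξ - x)) * em + (s x * heaviside (x - E.ξ)) * ep
  rw [h2] at h3
  rw [h3] at h1
  simp only [interface, polyDA]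
  simp only [Fin.sum_univ_three] at h1 ⊢
  linear_combination h1

/-- Star products are unique, so the products in a solution are those computed from the normal form,
whose combination is `interface`. -/
theorem isSolution_iff (hA : Φ ∈ spaceA) (hΦ : Rep Φ E.ξ um up p)
    (hm : IsBeamSol E.aMinus E.cMinus um) (hp : IsBeamSol E.aPlus E.cPlus up) :
    E.IsSolution Φ ↔ ∀ s ∈ testSub Set.univ, E.interface um up p s = 0 := by
  obtain ⟨P, Q, R, S, hP, hQ, hR, hS, hs⟩ := exists_products hΦ hm hp
  constructor
  · rintro ⟨-, P', Q', R', S', hP', hQ', hR', hS', h0⟩ s hs'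
    obtain rfl : P' = P := funext fun i => (hP' i).unique (hP i)
    obtain rfl : Q' = Q := funext fun i => (hQ' i).unique (hQ i)
    rw [← hs s hs', hR.unique hR', hS.unique hS', h0, cev_zero_dist hs']
  · intro h
    refine ⟨hA, P, Q, R, S, hP, hQ, hR, hS, dist_ext fun s hs' => ?_⟩
    rw [hs s hs', h s hs', cev_zero_dist hs']

theorem natDegree_polyA_le (i : Fin 2) : (E.polyA i).natDegree ≤ 1 := natDegree_sum_monomial_le _

theorem natDegree_polyB_le (i : Fin 2) : (E.polyB i).natDegree ≤ 3 := natDegree_sum_monomial_le _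

/-- Test with `(x - ξ)^(n+4)` times a cutoff, `n` the degree of `p`. The only term of that order
comes from `φ''''`, multiplied by `a_{0-}(ξ)` from one side and by `a_{1+}(ξ)` from the other, so
the leading coefficient of `p` vanishes. -/
theorem eq_zero_of_interface (ha : E.a E.ξ ≠ 0) (hm : ContDiff ℝ ∞ um) (hp : ContDiff ℝ ∞ up)
    (h : ∀ s ∈ testSub Set.univ, E.interface um up p s = 0) : p = 0 := by
  obtain ⟨χ, hχ, hχ1⟩ := exists_testSub_eq_one E.ξ
  set n := p.natDegree with hn
  have h1 := h _ (mul_mem_testSub (contDiff_shiftPow E.ξ (n + 4)) hχ)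
  -- The point parts of `a_j^{(i)}` have degree at most `1 + 2 = 3`, and those of `b_j` at most `3`:
  -- too low to reach `n + 4`, even for `n = 0`.
  have hA : ∀ (j : Fin 2) (i : ℕ), i ≤ 2 → (E.polyDA j i).natDegree ≤ n + 4 ∧
      (E.polyDA j i).coeff (n + 4) = 0 := by
    intro j i hi
    have h2 := natDegree_derivDelta_le E.ξ (E.am j) (E.ap j) (E.polyA j) i
    have h3 := natDegree_polyA_le (E := E) j
    have h4 : (E.polyDA j i).natDegree ≤ (E.polyA j).natDegree + i := h2
    exact ⟨by omega, coeff_eq_zero_of_natDegree_lt (by omega)⟩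
  have hB : ∀ j : Fin 2, (E.polyB j).natDegree ≤ n + 4 ∧ (E.polyB j).coeff (n + 4) = 0 := by
    intro j
    have h3 := natDegree_polyB_le (E := E) j
    exact ⟨by omega, coeff_eq_zero_of_natDegree_lt (by omega)⟩
  have hD := natDegree_derivDelta_le E.ξ um up p
  have hD' : ∀ k ≤ 4, (derivDelta E.ξ um up p k).natDegree ≤ n + 4 := fun k hk => by
    have := hD k; omega
  have c4 : (derivDelta E.ξ um up p 4).coeff (n + 4) = p.coeff n := derivDelta_coeff _ _ _ _ _ _
  have c3 : (derivDelta E.ξ um up p 3).coeff (n + 4) = 0 :=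
    coeff_eq_zero_of_natDegree_lt (by have := hD 3; omega)
  have c2 : (derivDelta E.ξ um up p 2).coeff (n + 4) = 0 :=
    coeff_eq_zero_of_natDegree_lt (by have := hD 2; omega)
  have c0 : p.coeff (n + 4) = 0 := coeff_eq_zero_of_natDegree_lt (by omega)
  have dm := contDiff_iteratedDeriv hm
  have dp := contDiff_iteratedDeriv hp
  have d0 := contDiff_iteratedDeriv (E.am_smooth 0)
  have d1 := contDiff_iteratedDeriv (E.ap_smooth 1)
  simp only [interface, Fin.sum_univ_three, Fin.val_zero, Fin.val_one, Fin.val_two, Nat.sub_zero,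
    show 4 - 1 = 3 from rfl, show 4 - 2 = 2 from rfl] at h1
  rw [deltaPair_mul_shiftPow _ (hA 0 0 (by omega)).1 (dp _) hχ.1,
    deltaPair_mul_shiftPow _ (hA 0 1 (by omega)).1 (dp _) hχ.1,
    deltaPair_mul_shiftPow _ (hA 0 2 (by omega)).1 (dp _) hχ.1,
    deltaPair_mul_shiftPow _ (hA 1 0 (by omega)).1 (dm _) hχ.1,
    deltaPair_mul_shiftPow _ (hA 1 1 (by omega)).1 (dm _) hχ.1,
    deltaPair_mul_shiftPow _ (hA 1 2 (by omega)).1 (dm _) hχ.1,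
    deltaPair_mul_shiftPow _ (hD' 4 (by omega)) (d0 _) hχ.1,
    deltaPair_mul_shiftPow _ (hD' 3 (by omega)) (d0 _) hχ.1,
    deltaPair_mul_shiftPow _ (hD' 2 (by omega)) (d0 _) hχ.1,
    deltaPair_mul_shiftPow _ (hD' 4 (by omega)) (d1 _) hχ.1,
    deltaPair_mul_shiftPow _ (hD' 3 (by omega)) (d1 _) hχ.1,
    deltaPair_mul_shiftPow _ (hD' 2 (by omega)) (d1 _) hχ.1,
    deltaPair_mul_shiftPow _ (hB 0).1 hp hχ.1, deltaPair_mul_shiftPow _ (hB 1).1 hm hχ.1,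
    deltaPair_mul_shiftPow _ (show p.natDegree ≤ n + 4 by omega) (E.bm_smooth 0) hχ.1,
    deltaPair_mul_shiftPow _ (show p.natDegree ≤ n + 4 by omega) (E.bp_smooth 1) hχ.1,
    (hA 0 0 (by omega)).2, (hA 0 1 (by omega)).2, (hA 0 2 (by omega)).2,
    (hA 1 0 (by omega)).2, (hA 1 1 (by omega)).2, (hA 1 2 (by omega)).2,
    (hB 0).2, (hB 1).2, c4, c3, c2, c0, hχ1] at h1
  have h2 : ((-1) ^ (n + 4) * ((n + 4).factorial : ℂ)) * (E.a E.ξ * p.coeff n) = 0 := by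
    simp only [iteratedDeriv_zero, Nat.choose, Nat.cast_one] at h1
    simp only [a]
    linear_combination h1
  have h3 : ((-1) ^ (n + 4) * ((n + 4).factorial : ℂ)) ≠ 0 :=
    mul_ne_zero (pow_ne_zero _ (by norm_num)) (by exact_mod_cast Nat.factorial_ne_zero _)
  have h4 : p.coeff n = 0 := by
    rcases mul_eq_zero.1 h2 with h | h
    · exact absurd h h3
    · exact (mul_eq_zero.1 h).resolve_left ha
  exact leadingCoeff_eq_zero.1 h4

/-- The derivatives of orders `0, 1, 2, 3` of `u` at `x`. -/
def _root_.Beam.jet (u : ℝ → ℂ) (x : ℝ) (i : Fin 4) : ℂ := iteratedDeriv i u x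

theorem deltaPair_polyA (i : Fin 2) (x : ℝ) (s : ℝ → ℂ) :
    deltaPair x s (E.polyA i) = E.A i 0 * iteratedDeriv 0 s x - E.A i 1 * iteratedDeriv 1 s x := by
  rw [polyA, map_sum, Fin.sum_univ_two, deltaPair_monomial, deltaPair_monomial, Fin.val_zero,
    Fin.val_one]
  ring

theorem deltaPair_polyB (i : Fin 2) (x : ℝ) (s : ℝ → ℂ) :
    deltaPair x s (E.polyB i) = E.B i 0 * iteratedDeriv 0 s x - E.B i 1 * iteratedDeriv 1 s x +
      E.B i 2 * iteratedDeriv 2 s x - E.B i 3 * iteratedDeriv 3 s x := by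
  rw [polyB, map_sum, Fin.sum_univ_four, deltaPair_monomial, deltaPair_monomial,
    deltaPair_monomial, deltaPair_monomial, Fin.val_zero, Fin.val_one, Fin.val_two,
    show ((3 : Fin 4) : ℕ) = 3 from rfl]
  ring

/-- This is the origin of `𝐀` and `𝐁`. A priori derivatives of `um`, `up` up to order `5` enter
through the point parts of the `a_i`, but `u'''' s - 2 (u''' s)' + (u'' s)'' = u'' s''`, so with `p
= 0` only orders up to `3` remain, both for the branches and for `s`. -/
theorem interface_zero (hm : ContDiff ℝ ∞ um) (hp : ContDiff ℝ ∞ up) (hs : ContDiff ℝ ∞ s) :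
    E.interface um up 0 s = ∑ m : Fin 4, (-1) ^ (m : ℕ) *
      (E.matB.mulVec (jet up E.ξ) - E.matA.mulVec (jet um E.ξ)) m * iteratedDeriv m s E.ξ := by
  have b1 := iteratedDeriv_aMinus (E := E) 1 E.ξ
  have b2 := iteratedDeriv_aPlus (E := E) 1 E.ξ
  have b3 := iteratedDeriv_a (E := E) 1 E.ξ
  rw [iteratedDeriv_one] at b1 b2 b3
  have b4 : E.aMinus E.ξ = iteratedDeriv 0 (E.am 0) E.ξ + iteratedDeriv 0 (E.am 1) E.ξ := rfl
  have b5 : E.aPlus E.ξ = iteratedDeriv 0 (E.ap 0) E.ξ + iteratedDeriv 0 (E.ap 1) E.ξ := rfl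
  have b6 : E.a E.ξ = iteratedDeriv 0 (E.am 0) E.ξ + iteratedDeriv 0 (E.ap 1) E.ξ := rfl
  simp only [interface, polyDA, deltaPair_derivDelta, map_zero, deltaPair_polyA, deltaPair_polyB,
    iteratedDeriv_iteratedDeriv, leibniz_left (E.am_smooth 0) hs,
    leibniz_left (E.ap_smooth 1) hs, leibniz_left hm hs, leibniz_left hp hs, leibniz hm hs,
    leibniz hp hs, matA, matB, b1, b2, b3, b4, b5, b6, Fin.sum_univ_three,
    Fin.sum_univ_four, Matrix.mulVec, dotProduct, Pi.sub_apply, jet, Finset.sum_range_succ,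
    Finset.sum_range_zero, Matrix.of_apply, Matrix.cons_val, Fin.val_zero, Fin.val_one,
    Fin.val_two]
  norm_num [Nat.choose, -iteratedDeriv_zero, -iteratedDeriv_one]
  ring

end Data

end

section

variable {U V : Set ℝ} {a c f g h s t u v fm fp um up : ℝ → ℂ} {Φ : Dist} {ξ x₀ : ℝ}
  {C : Fin 4 → ℂ}

/-! ### Structure of the solutions -/

theorem deriv_deriv_add_mul (hf : ContDiff ℝ ∞ f) (hg : ContDiff ℝ ∞ g) (hs : ContDiff ℝ ∞ s) :
    deriv (deriv ((f + g) * s)) = deriv (deriv (f * s)) + deriv (deriv (g * s)) := by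
  have h1 : ContDiff ℝ ∞ (f * s) := hf.mul hs
  have h2 : ContDiff ℝ ∞ (g * s) := hg.mul hs
  rw [add_mul, deriv_add_eq h1 h2, deriv_add_eq (contDiff_deriv h1) (contDiff_deriv h2)]

namespace Data

variable {E : Data}

/-- On `U` all star products are products with smooth functions. Moving the derivatives of `Φ` onto
the test function produces the adjoint of the beam operator, simplified by `beam_adjoint_identity`.
-/
theorem IsSolution.weak (hΦ : E.IsSolution Φ) (hU : IsOpen U) {α β : Fin 2 → ℝ → ℂ}
    (hα : ∀ i, ContDiff ℝ ∞ (α i)) (hβ : ∀ i, ContDiff ℝ ∞ (β i))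
    (hA : ∀ i k, EqFunOn (D k (E.coeffA i)) (iteratedDeriv k (α i)) U)
    (hB : ∀ i, EqFunOn (E.coeffB i) (β i) U) (hs : s ∈ testSub U) :
    cev Φ (deriv (deriv ((α 0 + α 1) * deriv (deriv s)))) =
      cev Φ ((E.w ^ 2 • (β 0 + β 1)) * s) := by
  obtain ⟨hmem, P, Q, R, S, hP, hQ, hR, hS, h0⟩ := hΦ
  have hΦ := mem_derivLocInt_of_mem_spaceA hmem
  have hs' := testSub_univ hs
  have h1 := congrArg (fun F => cev F s) h0
  have hk := fun i k => contDiff_iteratedDeriv (hα i) k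
  have eP : ∀ i : Fin 3, cev (P i) s = (-1) ^ (4 - (i : ℕ)) *
      cev Φ (iteratedDeriv (4 - i) (iteratedDeriv i (α 0) * s)) := fun i => by
    rw [(hP i).cev_of_left (D_mem_derivLocInt hΦ _) hU (hk 0 i) (hA 0 i) hs,
      cev_D _ _ (testSub_univ (mul_mem_testSub (hk 0 i) hs))]
  have eQ : ∀ i : Fin 3, cev (Q i) s = (-1) ^ (4 - (i : ℕ)) *
      cev Φ (iteratedDeriv (4 - i) (iteratedDeriv i (α 1) * s)) := fun i => by
    rw [(hQ i).cev_of_right (D_mem_derivLocInt hΦ _) hU (hk 1 i) (hA 1 i) hs,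
      cev_D _ _ (testSub_univ (mul_mem_testSub (hk 1 i) hs))]
  rw [cev_zero_dist hs', cev_sub_dist _ _ hs', cev_sum_dist _ _ hs', cev_smul_dist _ _ hs',
    cev_add_dist _ _ hs', hR.cev_of_left hΦ hU (hβ 0) (hB 0) hs,
    hS.cev_of_right hΦ hU (hβ 1) (hB 1) hs] at h1
  simp only [cev_smul_dist _ _ hs', cev_add_dist _ _ hs', eP, eQ, Fin.sum_univ_three,
    Fin.val_zero, Fin.val_one, Fin.val_two, Nat.sub_zero, show 4 - 1 = 3 from rfl,
    show 4 - 2 = 2 from rfl, iteratedDeriv_zero (f := α _)] at h1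
  rw [deriv_deriv_add_mul (hα 0) (hα 1) (contDiff_deriv (contDiff_deriv hs.1)), map_add,
    ← beam_adjoint_identity (hα 0) hs.1, ← beam_adjoint_identity (hα 1) hs.1, smul_mul_assoc,
    add_mul]
  simp only [map_add, map_sub, map_smul, smul_eq_mul]
  norm_num [Nat.choose, -iteratedDeriv_one] at h1
  linear_combination h1

/-- Since the branches are smooth across `ξ`, their jets at `ξ` make sense and carry the whole
interface condition once the point part is known to vanish. -/
theorem IsSolution.exists_eq_regular (hΦ : E.IsSolution Φ) (ha : E.a E.ξ ≠ 0)
    (ha' : ∀ x, E.aMinus x ≠ 0 ∧ E.aPlus x ≠ 0) :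
    ∃ um up, IsBeamSol E.aMinus E.cMinus um ∧ IsBeamSol E.aPlus E.cPlus up ∧
      Φ = regular (pw E.ξ um up) ∧
      E.matA.mulVec (jet um E.ξ) = E.matB.mulVec (jet up E.ξ) := by
  obtain ⟨um, hm, hml⟩ := exists_isBeamSol_of_weak Set.ordConnected_Iio isOpen_Iio
    Set.nonempty_Iio contDiff_aMinus (fun x => (ha' x).1) contDiff_cMinus
    (fun s hs => hΦ.weak (U := Set.Iio E.ξ) isOpen_Iio E.am_smooth E.bm_smooth
      (fun i k => ((rep_coeffA i).D k).eqFunOn_left) (fun i => (rep_coeffB i).eqFunOn_left) hs)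
  obtain ⟨up, hp, hpr⟩ := exists_isBeamSol_of_weak Set.ordConnected_Ioi isOpen_Ioi
    Set.nonempty_Ioi contDiff_aPlus (fun x => (ha' x).2) contDiff_cPlus
    (fun s hs => hΦ.weak (U := Set.Ioi E.ξ) isOpen_Ioi E.ap_smooth E.bp_smooth
      (fun i k => ((rep_coeffA i).D k).eqFunOn_right) (fun i => (rep_coeffB i).eqFunOn_right) hs)
  obtain ⟨p, hrep⟩ := exists_rep (mem_derivLocInt_of_mem_spaceA hΦ.1) hm.smooth hp.smooth hml hpr
  have hint := (isSolution_iff hΦ.1 hrep hm hp).1 hΦ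
  obtain rfl : p = 0 := eq_zero_of_interface ha hm.smooth hp.smooth hint
  refine ⟨um, up, hm, hp, dist_ext fun s hs => ?_, ?_⟩
  · rw [hrep.cev_eq s hs, (rep_regular_pw hm.smooth hp.smooth).cev_eq s hs]
  · have h0 := eq_zero_of_jet (ξ := E.ξ) fun s hs => by
      rw [← interface_zero hm.smooth hp.smooth hs.1]; exact hint s hs
    exact (sub_eq_zero.1 h0).symm

theorem isSolution_regular (hm : IsBeamSol E.aMinus E.cMinus um) (hp : IsBeamSol E.aPlus E.cPlus up)
    (h : E.matA.mulVec (jet um E.ξ) = E.matB.mulVec (jet up E.ξ)) :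
    E.IsSolution (regular (pw E.ξ um up)) := by
  refine (isSolution_iff ⟨0, _, piecewiseSmooth_pw hm.smooth hp.smooth, rfl⟩
    (rep_regular_pw hm.smooth hp.smooth) hm hp).2 fun s hs => ?_
  rw [interface_zero hm.smooth hp.smooth hs.1, h, sub_self]
  simp

end Data

/-! ### Boundary data and well-posedness -/

theorem EqFunOn.mono {F : Dist} (hF : EqFunOn F f U) (hV : V ⊆ U) : EqFunOn F f V :=
  fun t ht => hF t (ht.trans hV)

theorem hasBoundaryData_iff (hV : IsOpen V) (hx : x₀ ∈ V) (hu : ContDiff ℝ ∞ u)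
    (hΦ : EqFunOn Φ u V) : HasBoundaryData Φ x₀ C ↔ jet u x₀ = C := by
  constructor
  · rintro ⟨p, q, ψ, hp, hq, hψ, hψΦ, hC⟩
    have ho : IsOpen (Set.Ioo p q ∩ V) := isOpen_Ioo.inter hV
    have he := eqOn_of_eqFunOn ho hu.continuous.continuousOn hψ.continuous.continuousOn
      (hΦ.mono Set.inter_subset_right) (hψΦ.mono Set.inter_subset_left)
    ext i
    rw [← hC i]
    exact he.iteratedDeriv_of_isOpen ho i ⟨⟨hp, hq⟩, hx⟩
  · rintro rfl
    obtain ⟨r, hr, hrV⟩ := Metric.isOpen_iff.1 hV x₀ hx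
    rw [Real.ball_eq_Ioo] at hrV
    exact ⟨x₀ - r, x₀ + r, u, by linarith, by linarith, hu, hΦ.mono hrV, fun i => rfl⟩

/-- By continuity agreement reaches the closure; this is needed at `ξ`, a boundary point of the
half-line. -/
theorem jet_eq_of_eqOn (hV : IsOpen V) (hx : x₀ ∈ closure V) (hu : ContDiff ℝ ∞ u)
    (hv : ContDiff ℝ ∞ v) (h : Set.EqOn u v V) : jet u x₀ = jet v x₀ := by
  ext i
  exact (h.iteratedDeriv_of_isOpen hV i).closure (contDiff_iteratedDeriv hu i).continuous
    (contDiff_iteratedDeriv hv i).continuous hx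

theorem jet_eq_of_eqFunOn (hV : IsOpen V) (hx : x₀ ∈ closure V) (hu : ContDiff ℝ ∞ u)
    (hv : ContDiff ℝ ∞ v) (h1 : EqFunOn Φ u V) (h2 : EqFunOn Φ v V) : jet u x₀ = jet v x₀ :=
  jet_eq_of_eqOn hV hx hu hv
    (eqOn_of_eqFunOn hV hu.continuous.continuousOn hv.continuous.continuousOn h1 h2)

/-- The well-posedness criterion: the solutions are the pairs of solutions `k`, `u` of the equations
on the two sides whose jets satisfy the interface condition `K (jet k) = M (jet u)`, and the
boundary data determine `k`. -/
theorem existsUnique_iff_det_ne_zero {ak ck au cu : ℝ → ℂ} {Sol Bdry : Dist → Prop}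
    {mk : (ℝ → ℂ) → (ℝ → ℂ) → Dist} {K M : Matrix (Fin 4) (Fin 4) ℂ}
    (hak : ContDiff ℝ ∞ ak) (hak0 : ∀ x, ak x ≠ 0) (hck : ContDiff ℝ ∞ ck)
    (hau : ContDiff ℝ ∞ au) (hau0 : ∀ x, au x ≠ 0) (hcu : ContDiff ℝ ∞ cu)
    (h1 : ∀ Φ, Sol Φ → ∃ k u, IsBeamSol ak ck k ∧ IsBeamSol au cu u ∧ Φ = mk k u ∧
      K.mulVec (jet k ξ) = M.mulVec (jet u ξ))
    (h2 : ∀ k u, IsBeamSol ak ck k → IsBeamSol au cu u →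
      K.mulVec (jet k ξ) = M.mulVec (jet u ξ) → Sol (mk k u))
    (h3 : ∀ k u, IsBeamSol ak ck k → IsBeamSol au cu u → (Bdry (mk k u) ↔ jet k x₀ = C))
    (h4 : ∀ k u v, IsBeamSol ak ck k → IsBeamSol au cu u → IsBeamSol au cu v →
      mk k u = mk k v → jet u ξ = jet v ξ) :
    (∃! Φ, Sol Φ ∧ Bdry Φ) ↔ M.det ≠ 0 := by
  constructor
  -- A kernel vector `r` of `M` is the jet of a solution `v`. Replacing `u` by `u + v` keeps the
  -- interface condition and the boundary data, contradicting uniqueness whatever `C` is.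
  · rintro ⟨Φ, ⟨hS, hB⟩, huniq⟩ hdet
    obtain ⟨r, hr, hMr⟩ := Matrix.exists_mulVec_eq_zero_iff.2 hdet
    obtain ⟨k, u, hk, hu, rfl, hKM⟩ := h1 Φ hS
    obtain ⟨v, hv, hvr⟩ := exists_isBeamSol hau hau0 hcu ξ r
    have huv := hu.add_smul hau hv 1
    have hjet : jet (u + (1 : ℂ) • v) ξ = jet u ξ + r := by
      ext i
      rw [one_smul, Pi.add_apply, ← hvr i]
      exact iteratedDeriv_add (hu.smooth.contDiffAt.of_le (by exact_mod_cast le_top))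
        (hv.smooth.contDiffAt.of_le (by exact_mod_cast le_top))
    have hS' := h2 k _ hk huv (by rw [hjet, Matrix.mulVec_add, hMr, add_zero, hKM])
    have hB' := (h3 k _ hk huv).2 ((h3 k u hk hu).1 hB)
    have := h4 k _ u hk huv hu (huniq _ ⟨hS', hB'⟩)
    rw [hjet] at this
    exact hr (by simpa using this)
  · intro hdet
    have hunit : IsUnit M.det := isUnit_iff_ne_zero.2 hdet
    -- The data at `x₀` give `k`, and the interface condition, solved by `M⁻¹`, gives the jet of `u`
    -- at `ξ`.
    obtain ⟨k, hk, hkC⟩ := exists_isBeamSol hak hak0 hck x₀ C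
    obtain ⟨u, hu, hur⟩ := exists_isBeamSol hau hau0 hcu ξ (M⁻¹.mulVec (K.mulVec (jet k ξ)))
    have hur' : jet u ξ = M⁻¹.mulVec (K.mulVec (jet k ξ)) := funext hur
    refine ⟨mk k u, ⟨h2 k u hk hu ?_, (h3 k u hk hu).2 (funext hkC)⟩, ?_⟩
    · rw [hur', Matrix.mulVec_mulVec, Matrix.mul_nonsing_inv _ hunit, Matrix.one_mulVec]
    · rintro Φ ⟨hS, hB⟩
      obtain ⟨k', u', hk', hu', rfl, hKM⟩ := h1 Φ hS
      have hC := (h3 k' u' hk' hu').1 hB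
      obtain rfl : k' = k := hk'.eq_of_data hak hak0 hck hk (x₀ := x₀) fun i =>
        (congrFun hC i).trans (hkC i).symm
      have hju : jet u' ξ = jet u ξ := by
        rw [hur', hKM, Matrix.mulVec_mulVec, Matrix.nonsing_inv_mul _ hunit, Matrix.one_mulVec]
      rw [hu'.eq_of_data hau hau0 hcu hu (x₀ := ξ) fun i => congrFun hju i]

end

end Beam

end

theorem corollary3p4 (E : Beam.Data)
    (hC1 : E.a E.ξ ≠ 0)
    (hC2 : ∀ x : ℝ, E.aMinus x ≠ 0 ∧ E.aPlus x ≠ 0)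
    (x₀ : ℝ) (C : Fin 4 → ℂ) :
    (x₀ < E.ξ →
      ((∃! φ : Beam.Dist, E.IsSolution φ ∧ Beam.HasBoundaryData φ x₀ C) ↔ E.matB.det ≠ 0)) ∧
    (E.ξ < x₀ →
      ((∃! φ : Beam.Dist, E.IsSolution φ ∧ Beam.HasBoundaryData φ x₀ C) ↔ E.matA.det ≠ 0)) := by
  have hm0 := fun x => (hC2 x).1
  have hp0 := fun x => (hC2 x).2
  refine ⟨fun hx => ?_, fun hx => ?_⟩
  · refine Beam.existsUnique_iff_det_ne_zero (ξ := E.ξ) (K := E.matA) (x₀ := x₀) (C := C)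
      (mk := fun k u => Beam.regular (Beam.pw E.ξ k u))
      Beam.Data.contDiff_aMinus hm0 Beam.Data.contDiff_cMinus
      Beam.Data.contDiff_aPlus hp0 Beam.Data.contDiff_cPlus
      (fun Φ hΦ => hΦ.exists_eq_regular hC1 hC2)
      (fun k u hk hu h => Beam.Data.isSolution_regular hk hu h) (fun k u hk hu => ?_)
      (fun k u v hk hu hv h => ?_)
    · exact Beam.hasBoundaryData_iff isOpen_Iio hx hk.smooth
        (Beam.rep_regular_pw hk.smooth hu.smooth).eqFunOn_left
    · exact Beam.jet_eq_of_eqFunOn (V := Set.Ioi E.ξ) isOpen_Ioi (by simp) hu.smooth hv.smooth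
        (Beam.rep_regular_pw hk.smooth hu.smooth).eqFunOn_right
        (by rw [h]; exact (Beam.rep_regular_pw hk.smooth hv.smooth).eqFunOn_right)
  -- With `x₀` on the right, the known branch is the right one, so the matrices and the arguments of
  -- `pw` trade places.
  · refine Beam.existsUnique_iff_det_ne_zero (ξ := E.ξ) (K := E.matB) (x₀ := x₀) (C := C)
      (mk := fun k u => Beam.regular (Beam.pw E.ξ u k))
      Beam.Data.contDiff_aPlus hp0 Beam.Data.contDiff_cPlus
      Beam.Data.contDiff_aMinus hm0 Beam.Data.contDiff_cMinus
      (fun Φ hΦ => ?_)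
      (fun k u hk hu h => Beam.Data.isSolution_regular hu hk h.symm) (fun k u hk hu => ?_)
      (fun k u v hk hu hv h => ?_)
    · obtain ⟨um, up, hm, hp, he, hAB⟩ := hΦ.exists_eq_regular hC1 hC2
      exact ⟨up, um, hp, hm, he, hAB.symm⟩
    · exact Beam.hasBoundaryData_iff isOpen_Ioi hx hk.smooth
        (Beam.rep_regular_pw hu.smooth hk.smooth).eqFunOn_right
    · exact Beam.jet_eq_of_eqFunOn (V := Set.Iio E.ξ) isOpen_Iio (by simp) hu.smooth hv.smooth
        (Beam.rep_regular_pw hu.smooth hk.smooth).eqFunOn_left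
        (by rw [h]; exact (Beam.rep_regular_pw hv.smooth hk.smooth).eqFunOn_left)
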